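/- **Network.** Let $G=(V,E)$ be a finite directed graph. Node $i$ has processing capacity $C_i>0$ and storage $S_i\ge 0$, and link $(i,j)\in E$ has transmission capacity $C_{ij}>0$, per time slot. There is a finite set of databases $k$ with sizes $F_k\ge 0$. A *placement* is $x\in\{0,1\}^{V\times K}$ with $\sum_k F_k x_{i,k}\le S_i$ for all $i$; $\mathcal X$ is the set of placements. A service $\phi$ is a chain of $M_\phi-1\ge 0$ functions; function $m$ has scaling factor $\xi_m>0$, workload $r_m>0$, merging ratio $\zeta_m>0$ and database $k_m$. Put $\Xi_1=1$ and $\Xi_{m+1}=\xi_m\Xi_m$. There are finitely many clients $c=(s,d,\phi)$ (source, destination, service). A request of $c$ consists of a live packet entering at $s$, which has size $\Xi_m$ in stage $m$, and for each function $m$ a static packet of size $\Xi_m\zeta_m$. **Routes.** An *efficient route* $\sigma\in\mathcal F_c(x)$ consists of processing locations $\theta^{(1)},\dots,\theta^{(M_\phi-1)}\in V$ (with $\theta^{(0)}=s$, $\theta^{(M_\phi)}=d$), an acyclic path from $\theta^{(m-1)}$ to $\theta^{(m)}$ for the stage $m$ live packet ($1\le m\le M_\phi$), and an acyclic path from some node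 $v$ with $x_{v,k_m}=1$ to $\theta^{(m)}$ for the static packet of function $m$ ($1\le m\le M_\phi-1$). Its loads are $$\rho_i^{(c,\sigma)}=\sum_{m:\ \theta^{(m)}=i}\Xi_m r_m,\qquad \rho_{ij}^{(c,\sigma)}=\sum_{m:\ \text{stage } m\text{ live path crosses }(i,j)}\Xi_m+\sum_{m:\ \text{static path } m\text{ crosses }(i,j)}\Xi_m\zeta_m .$$ **Policies.** The arrival vectors $a(t)=(a^{(c)}(t))_c\in\mathbb N^{\{c\}}$ are i.i.d. over $t$, bounded, with mean $\lambda=(\lambda^{(c)})_c\ge 0$; queues are empty at time $0$. An admissible policy with database replacement (possibly randomized) chooses in every slot $t$ an arbitrary placement $x(t)\in\mathcal X$ that is non-anticipating (it depends only on information that is independent of $a(t)$, such as past arrivals), assigns to each request arriving in slot $t$ a route in $\mathcal F_c(x(t))$, possibly depending on $a(t)$, and schedules packets: the total resource spent in a slot at a node or link is at most its capacity, spent only on packets queued there; work on a packet may be spread over several slots. A packet moves on when its whole work is done, namely $\Xi_m$ (live) or $\Xi_m\zeta_m$ (static) per hop, and $\Xi_m r_m$ for processing by function $m$, which needs both the live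 and the static packet of the request at $\theta^{(m)}$. The policy stabilizes the network if almost surely $$\lim_{t\to\infty}\frac1t\Big[\sum_{i\in V}(R_i(t)+R_i'(t))+\sum_{(i,j)\in E}R_{ij}(t)\Big]=0,$$ where $R_i,R_i',R_{ij}$ are the total sizes of the packets in the processing queue (paired packets) and waiting queue (packets waiting for their associate) of $i$ and in the transmission queue of $(i,j)$. The stability region $\Lambda\subset\mathbb R_{\ge 0}^{\{c\}}$ is the set of those $\lambda$ such that all such arrivals with mean $\lambda$ can be stabilized by an admissible policy (which may depend on the arrival law). **Proposition.** Let $\lambda\in\mathbb R_{\ge0}^{\{c\}}$. (a) $\lambda\in\Lambda$ if and only if there exist $\mathbb P(x)\ge 0$ with $\sum_{x\in\mathcal X}\mathbb P(x)=1$, and $\mathbb P_{c,x}(\sigma)\ge 0$ for $x\in\mathcal X$, each client $c$ and $\sigma\in\mathcal F_c(x)$, with $\sum_{\sigma\in\mathcal F_c(x)}\mathbb P_{c,x}(\sigma)=1$ whenever $\mathbb P(x)>0$ and $\lambda^{(c)}>0$, such that for each node $i$ and link $(i,j)\in E$ $$\sum_{x\in\mathcal X}\mathbb P(x)\sum_c\lambda^{(c)}\sum_{\sigma\in\mathcal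 F_c(x)}\rho_i^{(c,\sigma)}\mathbb P_{c,x}(\sigma)\le C_i,\qquad \sum_{x\in\mathcal X}\mathbb P(x)\sum_c\lambda^{(c)}\sum_{\sigma\in\mathcal F_c(x)}\rho_{ij}^{(c,\sigma)}\mathbb P_{c,x}(\sigma)\le C_{ij}.$$ Moreover, for every law of bounded i.i.d. arrivals with mean $\lambda$, this condition is equivalent to the existence of an admissible policy that stabilizes the network under that law. (b) $\lambda$ is in the topological interior of $\Lambda$ relative to $\mathbb R_{\ge 0}^{\{c\}}$ if and only if there exist such $\mathbb P(x)$ and $\mathbb P_{c,x}(\sigma)$, with $\sum_{\sigma\in\mathcal F_c(x)}\mathbb P_{c,x}(\sigma)=1$ for all clients $c$ whenever $\mathbb P(x)>0$, for which all the inequalities above are strict. -/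

import Mathlib

open MeasureTheory ProbabilityTheory Filter Topology
open scoped NNReal BigOperators

/-- A cache-enabled edge cloud with node set `V`, database set `K`, service set `Φ` and client
set `Cl`. Service `φ` has `numFun φ` functions, hence `numFun φ + 1` stages; functions and stages
are numbered from `0`. -/
structure EdgeCloud (V K Φ Cl : Type) where
  /-- the directed network graph -/
  graph : Digraph V
  /-- processing capacity of a node, in instructions per slot -/
  procCap : V → ℝ
  /-- transmission capacity of a link, in data units per slot -/
  linkCap : V → V → ℝ
  procCap_pos : ∀ i, 0 < procCap i
  linkCap_pos : ∀ i j, graph.Adj i j → 0 < linkCap i j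
  /-- database sizes -/
  dbSize : K → ℝ≥0
  /-- storage capacities -/
  storage : V → ℝ≥0
  /-- number of functions of a service -/
  numFun : Φ → ℕ
  /-- scaling factor: output live packets per input live packet -/
  scaling : (φ : Φ) → Fin (numFun φ) → ℝ
  /-- workload: instructions per input live packet -/
  workload : (φ : Φ) → Fin (numFun φ) → ℝ
  /-- merging ratio: static objects per input live packet -/
  merging : (φ : Φ) → Fin (numFun φ) → ℝ
  /-- the database to which the static input of a function belongs -/
  object : (φ : Φ) → Fin (numFun φ) → K
  scaling_pos : ∀ φ m, 0 < scaling φ m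
  workload_pos : ∀ φ m, 0 < workload φ m
  merging_pos : ∀ φ m, 0 < merging φ m
  /-- source node of a client -/
  source : Cl → V
  /-- destination node of a client -/
  dest : Cl → V
  /-- service requested by a client -/
  service : Cl → Φ

/-- The list `l` of nodes is an acyclic directed path from `i` to `j`. -/
def IsAcyclicPath {V : Type} (G : Digraph V) (l : List V) (i j : V) : Prop :=
  l.Nodup ∧ l.IsChain G.Adj ∧ l.head? = some i ∧ l.getLast? = some j

/-- Hop number `h` of the path `l` is the link `(i, j)`. -/
def IsHop {V : Type} (l : List V) (h : ℕ) (i j : V) : Prop :=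
  l[h]? = some i ∧ l[h + 1]? = some j

/-- The path `l` crosses the link `(i, j)`. -/
def Crosses {V : Type} (l : List V) (i j : V) : Prop := ∃ h, IsHop l h i j

/-- The data of a route for a service with `n` functions: the processing location of every
function, the path of the live packet in every stage, and the path of every static object
(without the super static source that precedes it in the layered graph). -/
structure Route (V : Type) (n : ℕ) where
  loc : Fin n → V
  live : Fin (n + 1) → {l : List V // l.Nodup}
  static : Fin n → {l : List V // l.Nodup}

instance Route.instFinite (V : Type) [Finite V] (n : ℕ) : Finite (Route V n) := by
  classical
  have := Fintype.ofFinite V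
  refine Finite.of_injective
    (β := (Fin n → V) × (Fin (n + 1) → {l : List V // l.Nodup}) × (Fin n → {l : List V // l.Nodup}))
    (fun σ => (σ.loc, σ.live, σ.static)) ?_
  rintro ⟨a, b, c⟩ ⟨a', b', c'⟩ h
  simp only [Prod.mk.injEq] at h
  obtain ⟨rfl, rfl, rfl⟩ := h
  rfl

/-- The operations that a request has to undergo: hop `h` of the live packet in stage `m`, hop `h`
of the static packet of function `m`, and processing by function `m`. -/
inductive Operation (n : ℕ) where
  | live (m : Fin (n + 1)) (h : ℕ)
  | static (m : Fin n) (h : ℕ)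
  | proc (m : Fin n)

namespace EdgeCloud

variable {V K Φ Cl : Type}

section Routes

variable (N : EdgeCloud V K Φ Cl)

/-- The number of functions of the service of client `c`. -/
abbrev len (c : Cl) : ℕ := N.numFun (N.service c)

/-- Cumulative scaling factor: stage `m` live packets per initial live packet. -/
noncomputable def cumScaling (φ : Φ) (m : Fin (N.numFun φ + 1)) : ℝ :=
  Fin.induction (motive := fun _ => ℝ) 1 (fun k z => N.scaling φ k * z) m

/-- Size of the stage `m` live data of a request of client `c`. -/
noncomputable def liveSize (c : Cl) (m : Fin (N.len c + 1)) : ℝ :=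
  N.cumScaling (N.service c) m

/-- Size of the static data that function `m` needs for a request of client `c`. -/
noncomputable def staticSize (c : Cl) (m : Fin (N.len c)) : ℝ :=
  N.cumScaling (N.service c) m.castSucc * N.merging (N.service c) m

/-- Processing work of function `m` for a request of client `c`. -/
noncomputable def procWork (c : Cl) (m : Fin (N.len c)) : ℝ :=
  N.cumScaling (N.service c) m.castSucc * N.workload (N.service c) m

/-- The caching vectors that satisfy the storage constraint of every node. -/
def Placement [Fintype K] : Type :=
  {x : V → K → Bool // ∀ i, ∑ k, N.dbSize k * (if x i k = true then 1 else 0) ≤ N.storage i}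

instance instFinitePlacement [Fintype K] [Finite V] : Finite N.Placement := by
  unfold Placement; infer_instance

noncomputable instance instFintypePlacement [Fintype K] [Finite V] : Fintype N.Placement :=
  Fintype.ofFinite _

/-- `σ` is an efficient route for client `c` under placement `x`: in stage `m` the live packet
follows an acyclic path from the location of the previous function (or the source) to the
location of the next function (or the destination), and the static object of function `m` follows
an acyclic path from a node that caches the database to the location of function `m`. -/
def IsEfficientRoute [Fintype K] (c : Cl) (x : N.Placement) (σ : Route V (N.len c)) : Prop :=
  (∀ m : Fin (N.len c + 1), IsAcyclicPath N.graph (σ.live m).1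
      ((Fin.cons (N.source c) σ.loc : Fin (N.len c + 1) → V) m)
      ((Fin.snoc σ.loc (N.dest c) : Fin (N.len c + 1) → V) m)) ∧
  (∀ m : Fin (N.len c), ∃ v : V, x.1 v (N.object (N.service c) m) = true ∧
      IsAcyclicPath N.graph (σ.static m).1 v (σ.loc m))

/-- The set of efficient routes of client `c` under placement `x`. -/
def EfficientRoute [Fintype K] (c : Cl) (x : N.Placement) : Type :=
  {σ : Route V (N.len c) // N.IsEfficientRoute c x σ}

instance instFiniteEfficientRoute [Fintype K] [Finite V] (c : Cl) (x : N.Placement) :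
    Finite (N.EfficientRoute c x) := by
  unfold EfficientRoute; infer_instance

noncomputable instance instFintypeEfficientRoute [Fintype K] [Finite V] (c : Cl)
    (x : N.Placement) : Fintype (N.EfficientRoute c x) :=
  Fintype.ofFinite _

open Classical in
/-- Processing load put on node `i` by a request of client `c` that is delivered by `σ`. -/
noncomputable def nodeLoad (c : Cl) (σ : Route V (N.len c)) (i : V) : ℝ :=
  ∑ m, if σ.loc m = i then N.procWork c m else 0

open Classical in
/-- Transmission load put on link `(i, j)` by a request of client `c` that is delivered by `σ`. -/
noncomputable def linkLoad (c : Cl) (σ : Route V (N.len c)) (i j : V) : ℝ :=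
  (∑ m, if Crosses (σ.live m).1 i j then N.liveSize c m else 0) +
  ∑ m, if Crosses (σ.static m).1 i j then N.staticSize c m else 0

/-- Amount of resource needed to complete an operation of a request of client `c`. -/
noncomputable def work (c : Cl) : Operation (N.len c) → ℝ
  | .live m _ => N.liveSize c m
  | .static m _ => N.staticSize c m
  | .proc m => N.procWork c m

end Routes

section Progress

/-! Progress of a single request of client `c` that enters the network in slot `τ` with route `σ`,
where `s o u` is the amount of resource spent on operation `o` of the request in slot `u`. -/

variable (N : EdgeCloud V K Φ Cl) (c : Cl) (σ : Route V (N.len c)) (τ : ℕ)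
  (s : Operation (N.len c) → ℕ → ℝ)

/-- Operation `o` has been completed before slot `t`. -/
def Done (o : Operation (N.len c)) (t : ℕ) : Prop :=
  N.work c o ≤ ∑ u ∈ Finset.range t, s o u

/-- The stage `m` live packet is in the network by slot `t`: the request has arrived, and if
`m > 0` the preceding function has been executed. -/
def Released (m : Fin (N.len c + 1)) (t : ℕ) : Prop :=
  τ < t ∧ ∀ k : Fin (N.len c), k.succ = m → N.Done c s (.proc k) t

/-- By slot `t` the stage `m` live packet has reached the location of function `m`. -/
def LiveAt (m : Fin (N.len c)) (t : ℕ) : Prop :=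
  N.Released c τ s m.castSucc t ∧
    ∀ h, h + 1 < (σ.live m.castSucc).1.length → N.Done c s (.live m.castSucc h) t

/-- By slot `t` the static packet of function `m` has reached the location of function `m`. -/
def StaticAt (m : Fin (N.len c)) (t : ℕ) : Prop :=
  τ < t ∧ ∀ h, h + 1 < (σ.static m).1.length → N.Done c s (.static m h) t

/-- Operation `o` is in the corresponding transmission or processing queue at slot `t`. A packet
can take a hop only after its previous hops, and a function is executed only when both of its
inputs are present. -/
def Pending : Operation (N.len c) → ℕ → Prop
  | .live m h, t => h + 1 < (σ.live m).1.length ∧ N.Released c τ s m t ∧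
      (∀ h' < h, N.Done c s (.live m h') t) ∧ ¬ N.Done c s (.live m h) t
  | .static m h, t => h + 1 < (σ.static m).1.length ∧ τ < t ∧
      (∀ h' < h, N.Done c s (.static m h') t) ∧ ¬ N.Done c s (.static m h) t
  | .proc m, t => N.LiveAt c σ τ s m t ∧ N.StaticAt c σ τ s m t ∧ ¬ N.Done c s (.proc m) t

end Progress

/-- One realization of the controlled network. Request number `n` among the requests raised by
client `c` in slot `τ` (there are `arr τ c` of them) is delivered by `route c τ n`, and its
operation `o` receives the amount `serve c τ n o t` of resource in slot `t`. -/
structure Run [Fintype K] (N : EdgeCloud V K Φ Cl) where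
  arr : ℕ → Cl → ℕ
  place : ℕ → N.Placement
  route : (c : Cl) → ℕ → ℕ → Route V (N.len c)
  serve : (c : Cl) → ℕ → ℕ → Operation (N.len c) → ℕ → ℝ

namespace Run

variable [Fintype V] [Fintype K] [Fintype Cl] {N : EdgeCloud V K Φ Cl} (R : N.Run)

/-- Sum over all requests that have arrived before slot `t`. -/
noncomputable def sumReq (t : ℕ) (f : Cl → ℕ → ℕ → ℝ) : ℝ :=
  ∑ c, ∑ τ ∈ Finset.range t, ∑ n ∈ Finset.range (R.arr τ c), f c τ n

/-- Operation `o` of the `n`-th request of client `c` from slot `τ` is queued at slot `t`. -/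
def Queued (c : Cl) (τ n : ℕ) (o : Operation (N.len c)) (t : ℕ) : Prop :=
  N.Pending c (R.route c τ n) τ (R.serve c τ n) o t

open Classical in
/-- Processing resource of node `i` that is spent in slot `t`. -/
noncomputable def nodeUse (i : V) (t : ℕ) : ℝ :=
  R.sumReq t fun c τ n =>
    ∑ m, if (R.route c τ n).loc m = i then R.serve c τ n (.proc m) t else 0

open Classical in
/-- Transmission resource of link `(i, j)` that is spent in slot `t`. -/
noncomputable def linkUse (i j : V) (t : ℕ) : ℝ :=
  R.sumReq t fun c τ n =>
    (∑ m, ∑ h ∈ Finset.range ((R.route c τ n).live m).1.length,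
      if IsHop ((R.route c τ n).live m).1 h i j then R.serve c τ n (.live m h) t else 0) +
    ∑ m, ∑ h ∈ Finset.range ((R.route c τ n).static m).1.length,
      if IsHop ((R.route c τ n).static m).1 h i j then R.serve c τ n (.static m h) t else 0

/-- The decisions are admissible: every request gets, upon arrival, an efficient route for the
placement that is in force in that slot; resource is spent only on queued packets; and the
capacities are respected in every slot. -/
structure Admissible : Prop where
  route_mem : ∀ c τ n, n < R.arr τ c → N.IsEfficientRoute c (R.place τ) (R.route c τ n)
  serve_nonneg : ∀ c τ n o t, 0 ≤ R.serve c τ n o t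
  serve_queued : ∀ c τ n o t, R.serve c τ n o t ≠ 0 → R.Queued c τ n o t
  node_cap : ∀ i t, R.nodeUse i t ≤ N.procCap i
  link_cap : ∀ i j t, N.graph.Adj i j → R.linkUse i j t ≤ N.linkCap i j

open Classical in
/-- Backlog of the processing queue of node `i`: the paired live and static packets there. -/
noncomputable def procQueue (i : V) (t : ℕ) : ℝ :=
  R.sumReq t fun c τ n => ∑ m : Fin (N.len c),
    if (R.route c τ n).loc m = i ∧ R.Queued c τ n (.proc m) t then
      N.liveSize c m.castSucc + N.staticSize c m else 0

open Classical in
/-- Backlog of the waiting queue of node `i`: live and static packets that have reached their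
processing location before their associates. -/
noncomputable def waitQueue (i : V) (t : ℕ) : ℝ :=
  R.sumReq t fun c τ n => ∑ m : Fin (N.len c),
    ((if (R.route c τ n).loc m = i ∧
        N.LiveAt c (R.route c τ n) τ (R.serve c τ n) m t ∧
        ¬ N.StaticAt c (R.route c τ n) τ (R.serve c τ n) m t then
      N.liveSize c m.castSucc else 0) +
     (if (R.route c τ n).loc m = i ∧
        N.StaticAt c (R.route c τ n) τ (R.serve c τ n) m t ∧
        ¬ N.LiveAt c (R.route c τ n) τ (R.serve c τ n) m t then
      N.staticSize c m else 0))

open Classical in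
/-- Backlog of the transmission queue of link `(i, j)`. -/
noncomputable def linkQueue (i j : V) (t : ℕ) : ℝ :=
  R.sumReq t fun c τ n =>
    (∑ m, ∑ h ∈ Finset.range ((R.route c τ n).live m).1.length,
      if IsHop ((R.route c τ n).live m).1 h i j ∧ R.Queued c τ n (.live m h) t then
        N.liveSize c m else 0) +
    ∑ m, ∑ h ∈ Finset.range ((R.route c τ n).static m).1.length,
      if IsHop ((R.route c τ n).static m).1 h i j ∧ R.Queued c τ n (.static m h) t then
        N.staticSize c m else 0

open Classical in
/-- Total backlog of the actual queues. -/
noncomputable def backlog (t : ℕ) : ℝ :=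
  ∑ i, (R.procQueue i t + R.waitQueue i t) +
    ∑ i, ∑ j, if N.graph.Adj i j then R.linkQueue i j t else 0

/-- The total backlog grows sublinearly. -/
def RateStable : Prop :=
  Tendsto (fun t : ℕ => (1 / (t : ℝ)) * R.backlog t) atTop (𝓝 0)

end Run

/-- A randomized causal control policy with database replacement, together with the arrivals, on a
filtered probability space. `ℱ t` is what is known at the beginning of slot `t`, before the
arrivals of that slot. The arrivals of different slots are i.i.d. with law `ν`, and independent of
what is known before. The placement of slot `t` is arbitrary but is fixed before the arrivals of
that slot are seen; the routes of the new requests and the schedule of slot `t` may depend on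
these arrivals. -/
structure ControlledProcess [Fintype K] (N : EdgeCloud V K Φ Cl) (ν : Measure (Cl → ℕ))
    {Ω : Type} [mΩ : MeasurableSpace Ω] (μ : Measure Ω) (ℱ : Filtration ℕ mΩ) where
  run : Ω → N.Run
  arr_meas : ∀ t, Measurable[ℱ (t + 1)] fun ω => (run ω).arr t
  arr_law : ∀ t, μ.map (fun ω => (run ω).arr t) = ν
  arr_indep : ∀ t,
    Indep (MeasurableSpace.comap (fun ω => (run ω).arr t) inferInstance) (ℱ t) μ
  place_meas : ∀ t x, MeasurableSet[ℱ t] {ω | (run ω).place t = x}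
  route_meas : ∀ c t n σ, MeasurableSet[ℱ (t + 1)] {ω | (run ω).route c t n = σ}
  serve_meas : ∀ c τ n o t, Measurable[ℱ (t + 1)] fun ω => (run ω).serve c τ n o t

section Stability

variable [Fintype V] [Fintype K] [Fintype Cl] (N : EdgeCloud V K Φ Cl)

/-- `ν` is the one-slot law of bounded arrivals with mean rates `lam`. The arrivals of different
clients in the same slot may be dependent. -/
def IsArrivalLaw (lam : Cl → ℝ≥0) (ν : Measure (Cl → ℕ)) : Prop :=
  IsProbabilityMeasure ν ∧ (∃ A : Cl → ℕ, ∀ᵐ v ∂ν, ∀ c, v c ≤ A c) ∧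
    ∀ c, ∫ v, (v c : ℝ) ∂ν = lam c

/-- Some admissible policy with database replacement makes the actual queues rate stable, almost
surely, when the arrivals are i.i.d. over time with law `ν`. -/
def Stabilizable (ν : Measure (Cl → ℕ)) : Prop :=
  ∃ (Ω : Type) (mΩ : MeasurableSpace Ω) (μ : Measure Ω) (ℱ : Filtration ℕ mΩ)
    (S : ControlledProcess N ν μ ℱ),
    IsProbabilityMeasure μ ∧ ∀ᵐ ω ∂μ, (S.run ω).Admissible ∧ (S.run ω).RateStable

/-- The network stability region under database replacement, as a set of nonnegative arrival
vectors. -/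
def stabilityRegion : Set (Cl → ℝ≥0) :=
  {lam | ∀ ν : Measure (Cl → ℕ), IsArrivalLaw lam ν → N.Stabilizable ν}

/-- Expected processing load on node `i` when the placement has distribution `P`, the route of
client `c` under placement `x` has distribution `Q x c`, and the arrival rates are `lam`. -/
noncomputable def expNodeLoad (lam : Cl → ℝ≥0) (P : N.Placement → ℝ)
    (Q : (x : N.Placement) → (c : Cl) → N.EfficientRoute c x → ℝ) (i : V) : ℝ :=
  ∑ x, P x * ∑ c, (lam c : ℝ) * ∑ σ : N.EfficientRoute c x, N.nodeLoad c σ.1 i * Q x c σ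

/-- Expected transmission load on link `(i, j)`. -/
noncomputable def expLinkLoad (lam : Cl → ℝ≥0) (P : N.Placement → ℝ)
    (Q : (x : N.Placement) → (c : Cl) → N.EfficientRoute c x → ℝ) (i j : V) : ℝ :=
  ∑ x, P x * ∑ c, (lam c : ℝ) * ∑ σ : N.EfficientRoute c x, N.linkLoad c σ.1 i j * Q x c σ

/-- The capacity characterization of arrival vectors. Route distributions are needed only for
placements that are used and for clients that raise requests, since there may be no route at all
for the others. -/
def SatisfiesCapacity (lam : Cl → ℝ≥0) : Prop :=
  ∃ (P : N.Placement → ℝ) (Q : (x : N.Placement) → (c : Cl) → N.EfficientRoute c x → ℝ),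
    (∀ x, 0 ≤ P x) ∧ ∑ x, P x = 1 ∧ (∀ x c σ, 0 ≤ Q x c σ) ∧
    (∀ x c, 0 < P x → 0 < lam c → ∑ σ, Q x c σ = 1) ∧
    (∀ i, N.expNodeLoad lam P Q i ≤ N.procCap i) ∧
    (∀ i j, N.graph.Adj i j → N.expLinkLoad lam P Q i j ≤ N.linkCap i j)

/-- The same with slack in every capacity constraint, and with a route distribution for every
client, also for those with arrival rate zero. -/
def SatisfiesCapacityStrictly (lam : Cl → ℝ≥0) : Prop :=
  ∃ (P : N.Placement → ℝ) (Q : (x : N.Placement) → (c : Cl) → N.EfficientRoute c x → ℝ),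
    (∀ x, 0 ≤ P x) ∧ ∑ x, P x = 1 ∧ (∀ x c σ, 0 ≤ Q x c σ) ∧
    (∀ x c, 0 < P x → ∑ σ, Q x c σ = 1) ∧
    (∀ i, N.expNodeLoad lam P Q i < N.procCap i) ∧
    (∀ i j, N.graph.Adj i j → N.expLinkLoad lam P Q i j < N.linkCap i j)

end Stability

end EdgeCloud

/-!
The stability region is characterized by two arguments, one for each implication of
`EdgeCloud.stabilizable_iff`; both are uniform in the resource (node or link), because the load and
the use of a resource are sums over the operations `Route.nodeOps` or `Route.linkOps` that a route
performs there.

*Necessity* (`EdgeCloud.satisfiesCapacity_of_stabilizable`). Consider the expected frequencies, up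
to time `T`, of the placements and of the pairs of a placement and a route. Since the placement of
a slot is independent of its arrivals, the route frequencies add up to the arrival rate times the
frequency of the placement (`EdgeCloud.integral_sum_routeCount`). A request that is not finished
has a live packet in some queue (`EdgeCloud.exists_queued_of_not_finished`), so the number of
unfinished requests is bounded by a multiple of the backlog, and the load of all requests exceeds
the service by at most such a multiple (`EdgeCloud.Run.sumReq_work_le`). After division by `T` this
excess vanishes, by dominated convergence also in expectation
(`EdgeCloud.exists_tendsto_zero_load_le`). A limit point of the frequencies solves the capacity
inequalities.

*Sufficiency* (`EdgeCloud.stabilizable_of_satisfiesCapacity`). Draw the placement and the routes of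
every slot from the given distributions, independently over time and of the arrivals. Each route of
each client is treated as a separate fluid whose rate `q` is the mean number of requests per slot on
that route. A request reserves, upon arrival, the next free unit share of that fluid which begins
after its arrival slot (`reservation`), and each of its operations is executed at the rate of the
fluid during the interval of its share, delayed by a constant that depends on the phase of the
operation (`EdgeCloud.shareService`). Shares are disjoint, so the service on an operation never
exceeds `q` times its work (`sum_unitRamp_sub_le`), and adding up over routes and operations gives
the capacity constraints, with equality allowed. If the arrivals on a route have asymptotic rate
`q`, which is the strong law of large numbers, then the reservations run ahead of the fluid by a
sublinear number of shares only (`tendsto_card_reservation_gt`), so the number of unfinished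
requests, and with it the backlog, is sublinear.

For the interior, strict inequalities persist under small changes of the rates. Conversely, if
`(1 + ε) * lam + ε` satisfies the capacity inequalities for some `ε > 0`, then all clients have
routes and the inequalities for `lam` have slack.
-/

/-! ### Operations of a route and the resources they use -/

noncomputable instance Route.instFintype (V : Type) [Finite V] (n : ℕ) : Fintype (Route V n) :=
  Fintype.ofFinite _

theorem IsHop.eq_index {V : Type} {l : List V} (hl : l.Nodup) {h h' : ℕ} {i j : V}
    (h₁ : IsHop l h i j) (h₂ : IsHop l h' i j) : h = h' := by
  have hlt : h < l.length := by
    by_contra hc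
    have := h₁.1
    rw [List.getElem?_eq_none (by omega)] at this
    cases this
  exact (List.getElem?_inj hlt hl).1 (h₁.1.trans h₂.1.symm)

theorem IsHop.lt_length {V : Type} {l : List V} {h : ℕ} {i j : V} (h₁ : IsHop l h i j) :
    h + 1 < l.length := by
  by_contra hc
  have := h₁.2
  rw [List.getElem?_eq_none (by omega)] at this
  cases this

open Classical in
/-- An acyclic path crosses a link at most once. -/
theorem sum_isHop_eq_ite_crosses {V : Type} {l : List V} (hl : l.Nodup) (i j : V) (w : ℝ) :
    ∑ h ∈ Finset.range l.length, (if IsHop l h i j then w else 0) =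
      if Crosses l i j then w else 0 := by
  split_ifs with hc
  · obtain ⟨h, hh⟩ := hc
    rw [Finset.sum_eq_single h]
    · simp [hh]
    · intro h' _ hne
      rw [if_neg fun hh' => hne (hh'.eq_index hl hh)]
    · intro hn
      exact absurd (Finset.mem_range.2 (by have := hh.lt_length; omega)) hn
  · exact Finset.sum_eq_zero fun h _ => if_neg fun hh => hc ⟨h, hh⟩

theorem IsAcyclicPath.exists_isHop {V : Type} {G : Digraph V} {l : List V} {a b : V}
    (hl : IsAcyclicPath G l a b) {h : ℕ} (hh : h + 1 < l.length) :
    ∃ i j, G.Adj i j ∧ IsHop l h i j :=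
  ⟨l[h], l[h + 1], List.isChain_iff_getElem.1 hl.2.1 h hh,
    List.getElem?_eq_getElem _, List.getElem?_eq_getElem _⟩

namespace Route

variable {V : Type} {n : ℕ} (σ : Route V n)

/-- The operation `o` occurs on the route `σ`, that is, hop numbers stay within the path. -/
def HasOp : Operation n → Prop
  | .live m h => h + 1 < (σ.live m).1.length
  | .static m h => h + 1 < (σ.static m).1.length
  | .proc _ => True

open Classical in
/-- The operations of a request on route `σ` that use the processor of node `i`. -/
noncomputable def nodeOps (i : V) : Finset (Operation n) :=
  (Finset.univ.filter fun m => σ.loc m = i).image Operation.proc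

open Classical in
/-- The operations of a request on route `σ` that use the link `(i, j)`. -/
noncomputable def linkOps (i j : V) : Finset (Operation n) :=
  ((Finset.univ.sigma fun m => (Finset.range (σ.live m).1.length).filter
      fun h => IsHop (σ.live m).1 h i j).image fun p => Operation.live p.1 p.2) ∪
  ((Finset.univ.sigma fun m => (Finset.range (σ.static m).1.length).filter
      fun h => IsHop (σ.static m).1 h i j).image fun p => Operation.static p.1 p.2)

open Classical in
theorem sum_nodeOps (i : V) (f : Operation n → ℝ) :
    ∑ o ∈ σ.nodeOps i, f o = ∑ m, if σ.loc m = i then f (.proc m) else 0 := by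
  rw [nodeOps, Finset.sum_image (by intro a _ b _ h; simpa using h), Finset.sum_filter]

open Classical in
theorem sum_linkOps (i j : V) (f : Operation n → ℝ) :
    ∑ o ∈ σ.linkOps i j, f o =
      (∑ m, ∑ h ∈ Finset.range (σ.live m).1.length,
        if IsHop (σ.live m).1 h i j then f (.live m h) else 0) +
      ∑ m, ∑ h ∈ Finset.range (σ.static m).1.length,
        if IsHop (σ.static m).1 h i j then f (.static m h) else 0 := by
  rw [linkOps, Finset.sum_union, Finset.sum_image, Finset.sum_image, Finset.sum_sigma,
    Finset.sum_sigma]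
  · simp only [Finset.sum_filter]
  · rintro ⟨a, b⟩ _ ⟨c, d⟩ _ h
    simp only [Operation.static.injEq] at h
    obtain ⟨rfl, rfl⟩ := h
    rfl
  · rintro ⟨a, b⟩ _ ⟨c, d⟩ _ h
    simp only [Operation.live.injEq] at h
    obtain ⟨rfl, rfl⟩ := h
    rfl
  · rw [Finset.disjoint_left]
    intro o h₁ h₂
    simp only [Finset.mem_image] at h₁ h₂
    obtain ⟨_, _, rfl⟩ := h₁
    obtain ⟨_, _, h⟩ := h₂
    cases h

theorem hasOp_of_mem_nodeOps {i : V} {o : Operation n} (ho : o ∈ σ.nodeOps i) : σ.HasOp o := by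
  simp only [nodeOps, Finset.mem_image] at ho
  obtain ⟨_, _, rfl⟩ := ho
  trivial

theorem hasOp_of_mem_linkOps {i j : V} {o : Operation n} (ho : o ∈ σ.linkOps i j) :
    σ.HasOp o := by
  simp only [linkOps, Finset.mem_union, Finset.mem_image, Finset.mem_sigma,
    Finset.mem_filter] at ho
  obtain ⟨p, hp, rfl⟩ | ⟨p, hp, rfl⟩ := ho
  · exact hp.2.2.lt_length
  · exact hp.2.2.lt_length

end Route

namespace EdgeCloud

variable {V K Φ Cl : Type} (N : EdgeCloud V K Φ Cl)

theorem cumScaling_pos (φ : Φ) (m : Fin (N.numFun φ + 1)) : 0 < N.cumScaling φ m := by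
  unfold cumScaling
  induction m using Fin.induction with
  | zero => simp
  | succ k ih =>
    rw [Fin.induction_succ]
    exact mul_pos (N.scaling_pos _ _) ih

theorem liveSize_pos (c : Cl) (m) : 0 < N.liveSize c m := N.cumScaling_pos _ _

theorem staticSize_pos (c : Cl) (m) : 0 < N.staticSize c m :=
  mul_pos (N.cumScaling_pos _ _) (N.merging_pos _ _)

theorem procWork_pos (c : Cl) (m) : 0 < N.procWork c m :=
  mul_pos (N.cumScaling_pos _ _) (N.workload_pos _ _)

theorem work_pos (c : Cl) (o) : 0 < N.work c o := by
  cases o with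
  | live m h => exact N.liveSize_pos c m
  | static m h => exact N.staticSize_pos c m
  | proc m => exact N.procWork_pos c m

theorem nodeLoad_eq_sum (c : Cl) (σ : Route V (N.len c)) (i : V) :
    N.nodeLoad c σ i = ∑ o ∈ σ.nodeOps i, N.work c o := by
  classical
  rw [Route.sum_nodeOps, nodeLoad]
  rfl

theorem linkLoad_eq_sum (c : Cl) (σ : Route V (N.len c)) (i j : V) :
    N.linkLoad c σ i j = ∑ o ∈ σ.linkOps i j, N.work c o := by
  classical
  rw [Route.sum_linkOps, linkLoad]
  congr 1 <;> refine Finset.sum_congr rfl fun m _ => ?_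
  · exact (sum_isHop_eq_ite_crosses (σ.live m).2 i j _).symm
  · exact (sum_isHop_eq_ite_crosses (σ.static m).2 i j _).symm

theorem nodeLoad_nonneg (c : Cl) (σ : Route V (N.len c)) (i : V) : 0 ≤ N.nodeLoad c σ i := by
  rw [nodeLoad_eq_sum]
  exact Finset.sum_nonneg fun o _ => (N.work_pos c o).le

theorem linkLoad_nonneg (c : Cl) (σ : Route V (N.len c)) (i j : V) :
    0 ≤ N.linkLoad c σ i j := by
  rw [linkLoad_eq_sum]
  exact Finset.sum_nonneg fun o _ => (N.work_pos c o).le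

/-! ### Backlog of a single request -/

section Progress

variable {N} {c : Cl} {σ : Route V (N.len c)} {τ : ℕ} {s : Operation (N.len c) → ℕ → ℝ}

theorem Pending.arrived {o : Operation (N.len c)} {t : ℕ} (h : N.Pending c σ τ s o t) :
    τ < t := by
  cases o with
  | live m h' => exact h.2.1.1
  | static m h' => exact h.2.1
  | proc m => exact h.1.1.1

theorem Pending.hasOp {o : Operation (N.len c)} {t : ℕ} (h : N.Pending c σ τ s o t) :
    σ.HasOp o := by
  cases o with
  | live m h' => exact h.1
  | static m h' => exact h.1
  | proc m => trivial

theorem Pending.not_done {o : Operation (N.len c)} {t : ℕ} (h : N.Pending c σ τ s o t) :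
    ¬ N.Done c s o t := by
  cases o with
  | live m h' => exact h.2.2.2
  | static m h' => exact h.2.2.2
  | proc m => exact h.2.2

variable (N c σ s) in
/-- Every operation of the request has been completed before slot `t`. -/
def Finished (t : ℕ) : Prop := ∀ o, σ.HasOp o → N.Done c s o t

/-- As long as a request is not finished, its most advanced live packet is in a transmission
queue, in a waiting queue, or in a processing queue. -/
theorem exists_queued_of_not_finished {t : ℕ} (hτ : τ < t) (hf : ¬ Finished N c σ s t) :
    (∃ m h, N.Pending c σ τ s (.live m h) t) ∨
    (∃ m, N.LiveAt c σ τ s m t ∧ ¬ N.StaticAt c σ τ s m t) ∨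
    (∃ m, N.Pending c σ τ s (.proc m) t) := by
  by_contra! hcon
  obtain ⟨ha, hb, hc⟩ := hcon
  have hops : ∀ m, N.Released c τ s m t →
      ∀ h, h + 1 < (σ.live m).1.length → N.Done c s (.live m h) t := by
    intro m hm h
    induction h using Nat.strong_induction_on with
    | _ h ih =>
      intro hh
      by_contra hd
      exact ha m h ⟨hh, hm, fun h' hlt => ih h' hlt (by omega), hd⟩
  have hproc : ∀ m : Fin (N.len c), N.Released c τ s m.castSucc t →
      N.StaticAt c σ τ s m t ∧ N.Done c s (.proc m) t := by
    intro m hm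
    have hl : N.LiveAt c σ τ s m t := ⟨hm, hops _ hm⟩
    refine ⟨hb m hl, ?_⟩
    by_contra hd
    exact hc m ⟨hl, hb m hl, hd⟩
  have hrel : ∀ m, N.Released c τ s m t := by
    intro m
    induction m using Fin.induction with
    | zero => exact ⟨hτ, fun k hk => absurd hk (Fin.succ_ne_zero k)⟩
    | succ k ih =>
      refine ⟨hτ, fun k' hk' => ?_⟩
      obtain rfl := Fin.succ_injective _ hk'
      exact (hproc _ ih).2
  apply hf
  intro o ho
  cases o with
  | live m h => exact hops m (hrel m) h ho
  | static m h => exact (hproc m (hrel _)).1.2 h ho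
  | proc m => exact (hproc m (hrel _)).2

end Progress

section RequestBacklog

variable (c : Cl) (σ : Route V (N.len c)) (τ : ℕ) (s : Operation (N.len c) → ℕ → ℝ)

theorem ite_le_self {p : Prop} {_ : Decidable p} {w : ℝ} (hw : 0 ≤ w) :
    (if p then w else 0) ≤ w := by
  split_ifs <;> simp [hw]

theorem ite_self_nonneg {p : Prop} {_ : Decidable p} {w : ℝ} (hw : 0 ≤ w) :
    0 ≤ (if p then w else 0) := by
  split_ifs <;> simp [hw]

open Classical in
/-- Contribution of a single request to the processing queue of node `i`. -/
noncomputable def requestProc (t : ℕ) (i : V) : ℝ :=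
  ∑ m : Fin (N.len c), if σ.loc m = i ∧ N.Pending c σ τ s (.proc m) t then
      N.liveSize c m.castSucc + N.staticSize c m else 0

open Classical in
/-- Contribution of a single request to the waiting queue of node `i`. -/
noncomputable def requestWait (t : ℕ) (i : V) : ℝ :=
  ∑ m : Fin (N.len c),
    ((if σ.loc m = i ∧ N.LiveAt c σ τ s m t ∧ ¬ N.StaticAt c σ τ s m t then
      N.liveSize c m.castSucc else 0) +
     (if σ.loc m = i ∧ N.StaticAt c σ τ s m t ∧ ¬ N.LiveAt c σ τ s m t then
      N.staticSize c m else 0))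

open Classical in
/-- Contribution of a single request to the transmission queue of link `(i, j)`. -/
noncomputable def requestLink (t : ℕ) (i j : V) : ℝ :=
  (∑ m, ∑ h ∈ Finset.range (σ.live m).1.length,
      if IsHop (σ.live m).1 h i j ∧ N.Pending c σ τ s (.live m h) t then
        N.liveSize c m else 0) +
    ∑ m, ∑ h ∈ Finset.range (σ.static m).1.length,
      if IsHop (σ.static m).1 h i j ∧ N.Pending c σ τ s (.static m h) t then
        N.staticSize c m else 0

theorem requestProc_nonneg (t : ℕ) (i : V) : 0 ≤ N.requestProc c σ τ s t i :=
  Finset.sum_nonneg fun _ _ =>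
    ite_self_nonneg (add_nonneg (N.liveSize_pos c _).le (N.staticSize_pos c _).le)

theorem requestWait_nonneg (t : ℕ) (i : V) : 0 ≤ N.requestWait c σ τ s t i :=
  Finset.sum_nonneg fun _ _ => add_nonneg (ite_self_nonneg (N.liveSize_pos c _).le)
    (ite_self_nonneg (N.staticSize_pos c _).le)

theorem requestLink_nonneg (t : ℕ) (i j : V) : 0 ≤ N.requestLink c σ τ s t i j :=
  add_nonneg
    (Finset.sum_nonneg fun _ _ => Finset.sum_nonneg fun _ _ =>
      ite_self_nonneg (N.liveSize_pos c _).le)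
    (Finset.sum_nonneg fun _ _ => Finset.sum_nonneg fun _ _ =>
      ite_self_nonneg (N.staticSize_pos c _).le)

variable [Fintype V]

open Classical in
/-- Contribution of a single request to the total backlog. -/
noncomputable def requestBacklog (t : ℕ) : ℝ :=
  ∑ i, (N.requestProc c σ τ s t i + N.requestWait c σ τ s t i) +
    ∑ i, ∑ j, if N.graph.Adj i j then N.requestLink c σ τ s t i j else 0

/-- An upper bound on the backlog that a single request can cause. -/
noncomputable def maxBacklog : ℝ :=
  ∑ _i : V, (∑ m : Fin (N.len c), (N.liveSize c m.castSucc + N.staticSize c m) +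
    ∑ m : Fin (N.len c), (N.liveSize c m.castSucc + N.staticSize c m)) +
  ∑ _i : V, ∑ _j : V, ((∑ m, ∑ _h ∈ Finset.range (σ.live m).1.length, N.liveSize c m) +
    ∑ m, ∑ _h ∈ Finset.range (σ.static m).1.length, N.staticSize c m)

theorem requestBacklog_nonneg (t : ℕ) : 0 ≤ N.requestBacklog c σ τ s t :=
  add_nonneg
    (Finset.sum_nonneg fun _ _ =>
      add_nonneg (N.requestProc_nonneg ..) (N.requestWait_nonneg ..))
    (Finset.sum_nonneg fun _ _ => Finset.sum_nonneg fun _ _ =>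
      ite_self_nonneg (N.requestLink_nonneg ..))

theorem requestBacklog_le_maxBacklog (t : ℕ) :
    N.requestBacklog c σ τ s t ≤ N.maxBacklog c σ := by
  classical
  refine add_le_add (Finset.sum_le_sum fun i _ => add_le_add ?_ ?_)
    (Finset.sum_le_sum fun i _ => Finset.sum_le_sum fun j _ =>
      (ite_le_self (N.requestLink_nonneg ..)).trans (add_le_add ?_ ?_))
  · exact Finset.sum_le_sum fun m _ =>
      ite_le_self (add_nonneg (N.liveSize_pos c _).le (N.staticSize_pos c _).le)
  · exact Finset.sum_le_sum fun m _ => add_le_add (ite_le_self (N.liveSize_pos c _).le)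
      (ite_le_self (N.staticSize_pos c _).le)
  · exact Finset.sum_le_sum fun m _ => Finset.sum_le_sum fun h _ =>
      ite_le_self (N.liveSize_pos c _).le
  · exact Finset.sum_le_sum fun m _ => Finset.sum_le_sum fun h _ =>
      ite_le_self (N.staticSize_pos c _).le

variable {N c σ τ s}

theorem requestBacklog_of_finished {t : ℕ} (hτ : τ < t) (hf : Finished N c σ s t) :
    N.requestBacklog c σ τ s t = 0 := by
  classical
  have hp : ∀ o, ¬ N.Pending c σ τ s o t := fun o ho => ho.not_done (hf o ho.hasOp)
  have hst : ∀ m, N.StaticAt c σ τ s m t := fun m => ⟨hτ, fun h hh => hf (.static m h) hh⟩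
  have hlv : ∀ m, N.LiveAt c σ τ s m t := fun m =>
    ⟨⟨hτ, fun k _ => hf (.proc k) trivial⟩, fun h hh => hf (.live _ h) hh⟩
  simp [requestBacklog, requestProc, requestWait, requestLink, hp, hst, hlv]

theorem le_requestBacklog_of_not_finished [Fintype K] {x : N.Placement}
    (hσ : N.IsEfficientRoute c x σ) {δ : ℝ}
    (hδ : ∀ m, δ ≤ N.liveSize c m) {t : ℕ} (hτ : τ < t) (hf : ¬ Finished N c σ s t) :
    δ ≤ N.requestBacklog c σ τ s t := by
  classical
  have hP := N.requestProc_nonneg c σ τ s t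
  have hW := N.requestWait_nonneg c σ τ s t
  have hL := N.requestLink_nonneg c σ τ s t
  have hsum₁ : ∀ i, N.requestProc c σ τ s t i + N.requestWait c σ τ s t i ≤
      N.requestBacklog c σ τ s t := fun i =>
    (Finset.single_le_sum (f := fun i => N.requestProc c σ τ s t i + N.requestWait c σ τ s t i)
      (fun i _ => add_nonneg (hP i) (hW i)) (Finset.mem_univ i)).trans
      (le_add_of_nonneg_right (Finset.sum_nonneg fun _ _ => Finset.sum_nonneg fun _ _ =>
        ite_self_nonneg (hL _ _)))
  obtain ⟨m, h, hp⟩ | ⟨m, hl, hs⟩ | ⟨m, hp⟩ := exists_queued_of_not_finished hτ hf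
  · obtain ⟨i, j, hij, hh⟩ := (hσ.1 m).exists_isHop hp.hasOp
    calc δ ≤ N.liveSize c m := hδ m
      _ = if IsHop (σ.live m).1 h i j ∧ N.Pending c σ τ s (.live m h) t then
          N.liveSize c m else 0 := by rw [if_pos ⟨hh, hp⟩]
      _ ≤ ∑ h ∈ Finset.range (σ.live m).1.length,
          if IsHop (σ.live m).1 h i j ∧ N.Pending c σ τ s (.live m h) t then
            N.liveSize c m else 0 :=
        Finset.single_le_sum (f := fun h =>
          if IsHop (σ.live m).1 h i j ∧ N.Pending c σ τ s (.live m h) t then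
            N.liveSize c m else 0) (fun _ _ => ite_self_nonneg (N.liveSize_pos c _).le)
          (Finset.mem_range.2 (by have := hh.lt_length; omega))
      _ ≤ ∑ m, ∑ h ∈ Finset.range (σ.live m).1.length,
          if IsHop (σ.live m).1 h i j ∧ N.Pending c σ τ s (.live m h) t then
            N.liveSize c m else 0 :=
        Finset.single_le_sum (f := fun m => ∑ h ∈ Finset.range (σ.live m).1.length,
          if IsHop (σ.live m).1 h i j ∧ N.Pending c σ τ s (.live m h) t then
            N.liveSize c m else 0)
          (fun _ _ => Finset.sum_nonneg fun _ _ => ite_self_nonneg (N.liveSize_pos c _).le)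
          (Finset.mem_univ m)
      _ ≤ N.requestLink c σ τ s t i j :=
        le_add_of_nonneg_right (Finset.sum_nonneg fun _ _ => Finset.sum_nonneg fun _ _ =>
          ite_self_nonneg (N.staticSize_pos c _).le)
      _ = if N.graph.Adj i j then N.requestLink c σ τ s t i j else 0 := by rw [if_pos hij]
      _ ≤ ∑ j, if N.graph.Adj i j then N.requestLink c σ τ s t i j else 0 :=
        Finset.single_le_sum
          (f := fun j => if N.graph.Adj i j then N.requestLink c σ τ s t i j else 0)
          (fun _ _ => ite_self_nonneg (hL _ _)) (Finset.mem_univ j)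
      _ ≤ ∑ i, ∑ j, if N.graph.Adj i j then N.requestLink c σ τ s t i j else 0 :=
        Finset.single_le_sum
          (f := fun i => ∑ j, if N.graph.Adj i j then N.requestLink c σ τ s t i j else 0)
          (fun _ _ => Finset.sum_nonneg fun _ _ => ite_self_nonneg (hL _ _)) (Finset.mem_univ i)
      _ ≤ N.requestBacklog c σ τ s t :=
        le_add_of_nonneg_left (Finset.sum_nonneg fun i _ => add_nonneg (hP i) (hW i))
  · refine le_trans ?_ ((le_add_of_nonneg_left (hP _)).trans (hsum₁ (σ.loc m)))
    refine (hδ m.castSucc).trans (le_trans ?_ (Finset.single_le_sum (f := fun m =>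
      ((if σ.loc m = _ ∧ N.LiveAt c σ τ s m t ∧ ¬ N.StaticAt c σ τ s m t then
      N.liveSize c m.castSucc else 0) +
     (if σ.loc m = _ ∧ N.StaticAt c σ τ s m t ∧ ¬ N.LiveAt c σ τ s m t then
      N.staticSize c m else 0))) (fun _ _ =>
        add_nonneg (ite_self_nonneg (N.liveSize_pos c _).le)
        (ite_self_nonneg (N.staticSize_pos c _).le)) (Finset.mem_univ m)))
    simp [hl, hs]
  · refine le_trans ?_ ((le_add_of_nonneg_right (hW _)).trans (hsum₁ (σ.loc m)))
    refine (hδ m.castSucc).trans (le_trans ?_ (Finset.single_le_sum (f := fun m =>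
      if σ.loc m = _ ∧ N.Pending c σ τ s (.proc m) t then
      N.liveSize c m.castSucc + N.staticSize c m else 0) (fun _ _ =>
        ite_self_nonneg (add_nonneg (N.liveSize_pos c _).le (N.staticSize_pos c _).le))
        (Finset.mem_univ m)))
    simp [hp, (N.staticSize_pos c m).le]

end RequestBacklog

namespace Run

variable {N} [Fintype K] [Fintype Cl] (R : N.Run)

theorem sumReq_add (t : ℕ) (f g : Cl → ℕ → ℕ → ℝ) :
    (R.sumReq t fun c τ n => f c τ n + g c τ n) = R.sumReq t f + R.sumReq t g := by
  simp [sumReq, Finset.sum_add_distrib]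

theorem sumReq_finset_sum {ι : Type*} (u : Finset ι) (t : ℕ) (f : ι → Cl → ℕ → ℕ → ℝ) :
    (R.sumReq t fun c τ n => ∑ i ∈ u, f i c τ n) = ∑ i ∈ u, R.sumReq t (f i) := by
  classical
  induction u using Finset.induction_on with
  | empty => simp [sumReq]
  | insert a u ha ih => simp only [Finset.sum_insert ha, sumReq_add, ih]

theorem sumReq_const_mul (t : ℕ) (b : ℝ) (f : Cl → ℕ → ℕ → ℝ) :
    (R.sumReq t fun c τ n => b * f c τ n) = b * R.sumReq t f := by
  simp [sumReq, Finset.mul_sum]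

theorem sumReq_mono {t : ℕ} {f g : Cl → ℕ → ℕ → ℝ}
    (h : ∀ c τ n, τ < t → n < R.arr τ c → f c τ n ≤ g c τ n) : R.sumReq t f ≤ R.sumReq t g :=
  Finset.sum_le_sum fun _ _ => Finset.sum_le_sum fun _ hτ => Finset.sum_le_sum fun _ hn =>
    h _ _ _ (Finset.mem_range.1 hτ) (Finset.mem_range.1 hn)

theorem nodeUse_eq_sumReq (i : V) (t : ℕ) : R.nodeUse i t = R.sumReq t fun c τ n =>
    ∑ o ∈ (R.route c τ n).nodeOps i, R.serve c τ n o t := by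
  classical
  simp only [nodeUse, Route.sum_nodeOps]

theorem linkUse_eq_sumReq (i j : V) (t : ℕ) : R.linkUse i j t = R.sumReq t fun c τ n =>
    ∑ o ∈ (R.route c τ n).linkOps i j, R.serve c τ n o t := by
  classical
  simp only [linkUse, Route.sum_linkOps]

theorem backlog_eq_sumReq [Fintype V] (t : ℕ) : R.backlog t = R.sumReq t fun c τ n =>
    N.requestBacklog c (R.route c τ n) τ (R.serve c τ n) t := by
  classical
  have hlink : ∀ i j, (if N.graph.Adj i j then R.linkQueue i j t else 0) =
      R.sumReq t fun c τ n => if N.graph.Adj i j then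
        N.requestLink c (R.route c τ n) τ (R.serve c τ n) t i j else 0 := by
    intro i j
    split_ifs
    · rfl
    · simp [sumReq]
  simp only [requestBacklog, sumReq_add, sumReq_finset_sum, backlog, hlink]
  rfl

end Run

end EdgeCloud

/-! ### Reserving unit shares of a rate -/

/-- The truncation of a real number to the unit interval. -/
noncomputable def unitRamp (y : ℝ) : ℝ := max 0 (min y 1)

theorem unitRamp_le_one (y : ℝ) : unitRamp y ≤ 1 := max_le zero_le_one (min_le_right _ _)

theorem unitRamp_mono : Monotone unitRamp := fun _ _ h =>
  max_le_max le_rfl (min_le_min h le_rfl)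

theorem unitRamp_of_nonpos {y : ℝ} (h : y ≤ 0) : unitRamp y = 0 :=
  max_eq_left ((min_le_left _ _).trans h)

theorem unitRamp_of_one_le {y : ℝ} (h : 1 ≤ y) : unitRamp y = 1 := by
  simp [unitRamp, h]

theorem sum_range_unitRamp (y : ℝ) (M : ℕ) :
    ∑ k ∈ Finset.range M, unitRamp (y - k) = max 0 (min y M) := by
  induction M with
  | zero => simp
  | succ M ih =>
    have hM : (0 : ℝ) ≤ M := Nat.cast_nonneg M
    rw [Finset.sum_range_succ, ih]
    push_cast
    rcases le_total y M with h | h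
    · rw [unitRamp_of_nonpos (by linarith), min_eq_left h, min_eq_left (by linarith), add_zero]
    · rcases le_total y (M + 1) with h' | h'
      · rw [min_eq_right h, min_eq_left h', unitRamp, min_eq_left (by linarith),
          max_eq_right hM, max_eq_right (by linarith), max_eq_right (by linarith)]
        ring
      · rw [min_eq_right h, min_eq_right h', unitRamp_of_one_le (by linarith), max_eq_right hM,
          max_eq_right (by linarith)]

/-- Distinct unit shares of a fluid that arrives along the real line never add up to more than the
amount that has arrived. -/
theorem sum_unitRamp_sub_le {ι : Type*} {I : Finset ι} {k : ι → ℕ} (hk : Set.InjOn k I)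
    {y z : ℝ} (hyz : y ≤ z) :
    ∑ i ∈ I, (unitRamp (z - k i) - unitRamp (y - k i)) ≤ z - y := by
  classical
  rw [← Finset.sum_image (f := fun k : ℕ => unitRamp (z - k) - unitRamp (y - k)) hk]
  obtain ⟨M, hM⟩ := (I.image k).exists_nat_subset_range
  refine (Finset.sum_le_sum_of_subset_of_nonneg hM fun i _ _ =>
    sub_nonneg.2 (unitRamp_mono (by linarith))).trans ?_
  rw [Finset.sum_sub_distrib, sum_range_unitRamp, sum_range_unitRamp]
  have hM0 : (0 : ℝ) ≤ M := Nat.cast_nonneg M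
  rcases le_total y M with h | h <;> rcases le_total z M with h' | h' <;>
    simp only [min_eq_left, min_eq_right, h, h'] <;>
    rcases le_total 0 y with h0 | h0 <;> rcases le_total 0 z with h1 | h1 <;>
    simp only [max_eq_left, max_eq_right, h0, h1, hM0] <;> linarith

/-- The number of the share of a fluid of rate `q` that is reserved for the `n`-th request of slot
`τ`, when `a u` requests arrive in slot `u`. Requests are numbered consecutively, but a request
that arrives in slot `s` gets no share that begins before slot `s + 1`; the supremum is the closed
form of this first-come-first-served recursion. -/
noncomputable def reservation (q : ℝ) (a : ℕ → ℕ) (τ n : ℕ) : ℕ :=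
  (Finset.range (τ + 1)).sup (fun s => ⌈q * (s + 1)⌉₊ + ∑ u ∈ Finset.Ico s τ, a u) + n

theorem le_reservation (q : ℝ) (a : ℕ → ℕ) (τ n : ℕ) : q * (τ + 1) ≤ reservation q a τ n := by
  have h := Finset.le_sup (f := fun s : ℕ => ⌈q * (s + 1)⌉₊ + ∑ u ∈ Finset.Ico s τ, a u)
    (Finset.self_mem_range_succ τ)
  refine (Nat.le_ceil _).trans (Nat.cast_le.2 ?_)
  unfold reservation
  simp only [Finset.Ico_self, Finset.sum_empty, add_zero] at h
  omega

theorem exists_reservation_eq (q : ℝ) (a : ℕ → ℕ) (τ n : ℕ) :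
    ∃ s ≤ τ, reservation q a τ n = ⌈q * (s + 1)⌉₊ + ∑ u ∈ Finset.Ico s τ, a u + n := by
  obtain ⟨s, hs, h⟩ := Finset.exists_mem_eq_sup (Finset.range (τ + 1))
    ⟨0, by simp⟩ (fun s : ℕ => ⌈q * (s + 1)⌉₊ + ∑ u ∈ Finset.Ico s τ, a u)
  exact ⟨s, Nat.lt_succ_iff.1 (Finset.mem_range.1 hs), by rw [reservation, h]⟩

theorem reservation_lt_reservation (q : ℝ) {a : ℕ → ℕ} {τ τ' n : ℕ} (hτ : τ < τ') (hn : n < a τ)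
    (n' : ℕ) : reservation q a τ n < reservation q a τ' n' := by
  obtain ⟨s, hs, h⟩ := exists_reservation_eq q a τ n
  have h₁ := Finset.le_sup (f := fun s : ℕ => ⌈q * (s + 1)⌉₊ + ∑ u ∈ Finset.Ico s τ', a u)
    (Finset.mem_range.2 (show s < τ' + 1 by omega))
  have h₂ : ∑ u ∈ Finset.Ico s τ, a u + a τ ≤ ∑ u ∈ Finset.Ico s τ', a u := by
    rw [← Finset.sum_Ico_succ_top hs]
    exact Finset.sum_le_sum_of_subset (Finset.Ico_subset_Ico le_rfl hτ)
  rw [h]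
  unfold reservation
  omega

theorem reservation_congr {q : ℝ} {a b : ℕ → ℕ} {τ : ℕ} (h : ∀ u < τ, a u = b u) (n : ℕ) :
    reservation q a τ n = reservation q b τ n := by
  unfold reservation
  congr 1
  refine Finset.sup_congr rfl fun s _ => ?_
  congr 1
  exact Finset.sum_congr rfl fun u hu => h u (Finset.mem_Ico.1 hu).2

theorem reservation_injOn (q : ℝ) (a : ℕ → ℕ) (t : ℕ) :
    Set.InjOn (fun p : (_ : ℕ) × ℕ => reservation q a p.1 p.2)
      ((Finset.range t).sigma fun τ => Finset.range (a τ)) := by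
  rintro ⟨τ, n⟩ hp ⟨τ', n'⟩ hp' h
  simp only [Finset.coe_sigma, Set.mem_sigma_iff, Finset.coe_range, Set.mem_Iio] at hp hp'
  dsimp only at h
  rcases lt_trichotomy τ τ' with hlt | rfl | hlt
  · exact absurd h (reservation_lt_reservation q hlt hp.2 n').ne
  · unfold reservation at h
    obtain rfl : n = n' := by omega
    rfl
  · exact absurd h (reservation_lt_reservation q hlt hp'.2 n).ne'

/-- If the arrivals deviate from their rate by at most `b`, then the reserved shares lie
at most `2 * b` shares, up to a constant, ahead of the fluid. -/
theorem reservation_le {q b : ℝ} (hq : 0 ≤ q) {a : ℕ → ℕ} {t : ℕ}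
    (hb : ∀ s ≤ t, |(∑ u ∈ Finset.range s, (a u : ℝ)) - q * s| ≤ b) {τ n : ℕ}
    (hτ : τ < t) (hn : n < a τ) : (reservation q a τ n : ℝ) ≤ q * t + 2 * b + q + 1 := by
  obtain ⟨s, hs, h⟩ := exists_reservation_eq q a τ n
  have h₂ : (n : ℝ) + ∑ u ∈ Finset.Ico s τ, (a u : ℝ) + ∑ u ∈ Finset.range s, (a u : ℝ) ≤
      ∑ u ∈ Finset.range t, (a u : ℝ) := by
    rw [add_assoc, add_comm (∑ u ∈ Finset.Ico s τ, (a u : ℝ)), Finset.sum_range_add_sum_Ico _ hs]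
    have h₃ : ∑ u ∈ Finset.range (τ + 1), (a u : ℝ) ≤ ∑ u ∈ Finset.range t, (a u : ℝ) :=
      Finset.sum_le_sum_of_subset_of_nonneg (Finset.range_mono hτ) fun _ _ _ =>
        Nat.cast_nonneg _
    rw [Finset.sum_range_succ] at h₃
    have : (n : ℝ) ≤ a τ := by exact_mod_cast hn.le
    linarith
  have h₄ := abs_le.1 (hb s (by omega))
  have h₅ := abs_le.1 (hb t le_rfl)
  have h₆ := (Nat.ceil_lt_add_one (show 0 ≤ q * ((s : ℝ) + 1) by positivity)).le
  rw [h]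
  push_cast
  linarith

/-- Requests whose reserved share is at most `E` shares behind the fluid are few, because their
shares are distinct integers in a short interval. -/
theorem card_reservation_gt_le {q b : ℝ} (hq : 0 ≤ q) {a : ℕ → ℕ} {t : ℕ}
    (hb : ∀ s ≤ t, |(∑ u ∈ Finset.range s, (a u : ℝ)) - q * s| ≤ b) {E : ℝ} (hE : 0 ≤ E)
    {p : ℕ → ℕ → Prop} [∀ τ n, Decidable (p τ n)]
    (hp : ∀ τ n, τ < t → p τ n → q * t - E ≤ reservation q a τ n) :
    ∑ τ ∈ Finset.range t, ∑ n ∈ Finset.range (a τ), (if p τ n then (1 : ℝ) else 0) ≤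
      2 * b + q + E + 2 := by
  rw [Finset.sum_sigma', Finset.sum_boole]
  set F := ((Finset.range t).sigma fun τ => Finset.range (a τ)).filter fun x => p x.1 x.2
  have hb0 : 0 ≤ b := (abs_nonneg _).trans (hb 0 (Nat.zero_le _))
  have hup : 0 ≤ q * t + 2 * b + q + 1 := by positivity
  have hcard : F.card ≤ (Finset.Icc ⌈q * t - E⌉₊ ⌊q * t + 2 * b + q + 1⌋₊).card := by
    refine Finset.card_le_card_of_injOn (fun x => reservation q a x.1 x.2) ?_
      ((reservation_injOn q a t).mono (by exact_mod_cast Finset.filter_subset _ _))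
    rintro ⟨τ, n⟩ hx
    simp only [F, Finset.coe_filter, Finset.mem_sigma, Finset.mem_range, Set.mem_ofPred_eq] at hx
    rw [Finset.mem_coe, Finset.mem_Icc]
    exact ⟨Nat.ceil_le.2 (hp _ _ hx.1.1 hx.2), Nat.le_floor (reservation_le hq hb hx.1.1 hx.1.2)⟩
  rw [Nat.card_Icc] at hcard
  have h₁ := Nat.floor_le hup
  have h₂ := Nat.le_ceil (q * t - E)
  have h₃ : (F.card : ℝ) + ⌈q * t - E⌉₊ ≤ ⌊q * t + 2 * b + q + 1⌋₊ + 1 ∨ F.card = 0 := by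
    by_cases h0 : F.card = 0
    · exact Or.inr h0
    · left
      exact_mod_cast (show F.card + ⌈q * t - E⌉₊ ≤ ⌊q * t + 2 * b + q + 1⌋₊ + 1 by omega)
  rcases h₃ with h₃ | h₃
  · linarith
  · rw [h₃]
    push_cast
    positivity

theorem exists_abs_sub_le_of_tendsto {A : ℕ → ℝ} {q : ℝ}
    (h : Tendsto (fun t : ℕ => A t / t) atTop (𝓝 q)) {ε : ℝ} (hε : 0 < ε) :
    ∃ B, ∀ s : ℕ, |A s - q * s| ≤ ε * s + B := by
  obtain ⟨T, hT⟩ := Metric.tendsto_atTop.1 h ε hε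
  refine ⟨∑ s ∈ Finset.range (T + 1), |A s - q * s|, fun s => ?_⟩
  rcases lt_or_ge s (T + 1) with hs | hs
  · have := Finset.single_le_sum (f := fun s : ℕ => |A s - q * s|) (fun _ _ => abs_nonneg _)
      (Finset.mem_range.2 hs)
    have h0 : 0 ≤ ε * s := by positivity
    linarith
  · have hs0 : (0 : ℝ) < s := by exact_mod_cast (show 0 < s by omega)
    have := (hT s (by omega)).le
    rw [Real.dist_eq, div_sub' hs0.ne', abs_div, abs_of_pos hs0, div_le_iff₀ hs0,
      mul_comm (s : ℝ) q] at this
    have h0 : 0 ≤ ∑ s ∈ Finset.range (T + 1), |A s - q * s| :=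
      Finset.sum_nonneg fun _ _ => abs_nonneg _
    linarith

/-- When the arrivals have rate `q`, only a sublinear number of requests has not been overtaken
by the fluid, even with a constant delay `E`. -/
theorem tendsto_card_reservation_gt {q : ℝ} (hq : 0 ≤ q) {a : ℕ → ℕ}
    (ha : Tendsto (fun t : ℕ => (∑ u ∈ Finset.range t, (a u : ℝ)) / t) atTop (𝓝 q)) {E : ℝ}
    (hE : 0 ≤ E) {p : ℕ → ℕ → ℕ → Prop} [∀ t τ n, Decidable (p t τ n)]
    (hp : ∀ t τ n, τ < t → p t τ n → q * t - E ≤ reservation q a τ n) :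
    Tendsto (fun t : ℕ => 1 / (t : ℝ) * ∑ τ ∈ Finset.range t, ∑ n ∈ Finset.range (a τ),
      (if p t τ n then (1 : ℝ) else 0)) atTop (𝓝 0) := by
  rw [Metric.tendsto_atTop]
  intro ε hε
  obtain ⟨B, hB⟩ := exists_abs_sub_le_of_tendsto ha (show 0 < ε / 4 by positivity)
  obtain ⟨T, hT⟩ := exists_nat_gt ((2 * B + q + E + 2) / (ε / 2))
  refine ⟨T + 1, fun t ht => ?_⟩
  have ht0 : (0 : ℝ) < t := by exact_mod_cast (show 0 < t by omega)
  have hTt : (T : ℝ) ≤ t := by exact_mod_cast (show T ≤ t by omega)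
  have h₀ : 0 ≤ ∑ τ ∈ Finset.range t, ∑ n ∈ Finset.range (a τ),
      (if p t τ n then (1 : ℝ) else 0) :=
    Finset.sum_nonneg fun _ _ => Finset.sum_nonneg fun _ _ => by split_ifs <;> norm_num
  have h₁ := card_reservation_gt_le (b := ε / 4 * t + B) hq (fun s hs => (hB s).trans
    (by gcongr)) hE (hp t)
  rw [Real.dist_eq, sub_zero, abs_of_nonneg (by positivity), one_div, inv_mul_lt_iff₀ ht0]
  rw [div_lt_iff₀ (by positivity)] at hT
  nlinarith

/-! ### The reservation policy -/

namespace EdgeCloud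

variable {V K Φ Cl : Type}

/-- The phase in which an operation is executed. Every operation comes in a later phase than the
operations that it has to wait for. -/
def phase (V : Type) [Fintype V] {n : ℕ} : Operation n → ℕ
  | .live m h => m * (Fintype.card V + 1) + h
  | .static m h => m * (Fintype.card V + 1) + h
  | .proc m => m * (Fintype.card V + 1) + Fintype.card V

theorem phase_le [Fintype V] {n : ℕ} {σ : Route V n} {o : Operation n} (ho : σ.HasOp o) :
    phase V o ≤ (n + 1) * (Fintype.card V + 1) := by
  cases o with
  | live m h =>
    have h₁ : h + 1 < (σ.live m).1.length := ho
    have h₂ := (σ.live m).2.length_le_card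
    have h₃ := m.2
    simp only [phase]
    nlinarith
  | static m h =>
    have h₁ : h + 1 < (σ.static m).1.length := ho
    have h₂ := (σ.static m).2.length_le_card
    have h₃ := m.2
    simp only [phase]
    nlinarith
  | proc m =>
    have h₃ := m.2
    simp only [phase]
    nlinarith

/-- The fraction of an operation of phase `d` that has been done before slot `u`, for a request
that has share number `k` of a fluid of rate `q`. The delay of `1 / q + 1` slots between
consecutive phases, here in units of shares, makes one phase end in an earlier slot than the next
one begins, and gives a rate of zero no service. -/
noncomputable def progress (q : ℝ) (k d u : ℕ) : ℝ := unitRamp (q * u - d * (1 + q) - k)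

theorem progress_mono {q : ℝ} (hq : 0 ≤ q) (k d : ℕ) : Monotone (progress q k d) :=
  fun u v h => unitRamp_mono (by
    have : (u : ℝ) ≤ v := by exact_mod_cast h
    nlinarith)

theorem progress_zero {q : ℝ} (hq : 0 ≤ q) (k d : ℕ) : progress q k d 0 = 0 :=
  unitRamp_of_nonpos (by
    have : (0 : ℝ) ≤ d * (1 + q) := by positivity
    have : (0 : ℝ) ≤ k := by positivity
    push_cast
    linarith)

/-- If an operation of phase `d` is under way, then operations of earlier phases are complete. -/
theorem progress_eq_one {q : ℝ} (hq : 0 ≤ q) {k d d' u : ℕ} (hd : d' < d)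
    (h : progress q k d (u + 1) ≠ progress q k d u) : progress q k d' u = 1 := by
  refine unitRamp_of_one_le ?_
  by_contra! hc
  have hd' : ((d' : ℝ) + 1) * (1 + q) ≤ d * (1 + q) :=
    mul_le_mul_of_nonneg_right (by exact_mod_cast hd) (by positivity)
  apply h
  rw [progress, progress, unitRamp_of_nonpos, unitRamp_of_nonpos]
  · linarith
  · push_cast
    linarith

section Request

variable [Fintype V] (N : EdgeCloud V K Φ Cl) (c : Cl) (σ : Route V (N.len c)) (q : ℝ) (k : ℕ)

open Classical in
/-- The service that a request on route `σ` gets from share number `k` of a fluid of rate `q`. -/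
noncomputable def shareService (o : Operation (N.len c)) (u : ℕ) : ℝ :=
  if σ.HasOp o then
    N.work c o * (progress q k (phase V o) (u + 1) - progress q k (phase V o) u)
  else 0

variable {N c σ q k} (hq : 0 ≤ q)

include hq

theorem shareService_nonneg (o : Operation (N.len c)) (u : ℕ) :
    0 ≤ N.shareService c σ q k o u := by
  unfold shareService
  split_ifs
  · exact mul_nonneg (N.work_pos c o).le (sub_nonneg.2 (progress_mono hq _ _ (Nat.le_succ u)))
  · exact le_rfl

theorem sum_shareService {o : Operation (N.len c)} (ho : σ.HasOp o) (t : ℕ) :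
    ∑ u ∈ Finset.range t, N.shareService c σ q k o u =
      N.work c o * progress q k (phase V o) t := by
  simp only [shareService, if_pos ho]
  rw [← Finset.mul_sum, Finset.sum_range_sub, progress_zero hq, sub_zero]

theorem done_shareService_iff {o : Operation (N.len c)} (ho : σ.HasOp o) (t : ℕ) :
    N.Done c (N.shareService c σ q k) o t ↔ progress q k (phase V o) t = 1 := by
  rw [Done, sum_shareService hq ho, le_mul_iff_one_le_right (N.work_pos c o)]
  exact ⟨fun h => le_antisymm (unitRamp_le_one _) h, fun h => h.ge⟩

/-- A share that begins after the arrival of the request serves queued packets only. -/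
theorem pending_of_shareService_ne_zero {τ : ℕ} (hk : q * (τ + 1) ≤ k) {o : Operation (N.len c)}
    {u : ℕ} (h : N.shareService c σ q k o u ≠ 0) :
    N.Pending c σ τ (N.shareService c σ q k) o u := by
  have ho : σ.HasOp o := by
    by_contra hc
    exact h (if_neg hc)
  have hne : progress q k (phase V o) (u + 1) ≠ progress q k (phase V o) u := by
    intro he
    apply h
    rw [shareService, if_pos ho, he, sub_self, mul_zero]
  have hτ : τ < u := by
    by_contra! hc
    apply hne
    have h₀ : ∀ v ≤ τ + 1, progress q k (phase V o) v = 0 := by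
      intro v hv
      refine unitRamp_of_nonpos ?_
      have h₁ : q * v ≤ q * (τ + 1) := mul_le_mul_of_nonneg_left (by exact_mod_cast hv) hq
      have h₂ : 0 ≤ phase V o * (1 + q) := by positivity
      linarith
    rw [h₀ _ (by omega), h₀ _ (by omega)]
  have hearlier : ∀ o', σ.HasOp o' → phase V o' < phase V o →
      N.Done c (N.shareService c σ q k) o' u := fun o' ho' hlt =>
    (done_shareService_iff hq ho' u).2 (progress_eq_one hq hlt hne)
  have hnot : ¬ N.Done c (N.shareService c σ q k) o u := by
    rw [done_shareService_iff hq ho]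
    intro h₁
    apply hne
    have h₂ := progress_mono hq k (phase V o) (Nat.le_succ u)
    exact le_antisymm ((unitRamp_le_one _).trans h₁.ge) h₂
  -- All operations of the `m`-th block of phases come after processing by function `m - 1`.
  have hlive : ∀ (m : Fin (N.len c + 1)) (b : ℕ), phase V o = m * (Fintype.card V + 1) + b →
      N.Released c τ (N.shareService c σ q k) m u := by
    refine fun m b hb => ⟨hτ, ?_⟩
    rintro k' rfl
    refine hearlier _ trivial ?_
    rw [hb]
    simp only [phase, Fin.val_succ]
    nlinarith
  cases o with
  | live m i =>
    refine ⟨ho, hlive m i rfl, fun i' hi' => hearlier _ ?_ ?_, hnot⟩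
    · exact lt_trans (Nat.succ_lt_succ hi') ho
    · simpa [phase] using hi'
  | static m i =>
    refine ⟨ho, hτ, fun i' hi' => hearlier _ ?_ ?_, hnot⟩
    · exact lt_trans (Nat.succ_lt_succ hi') ho
    · simpa [phase] using hi'
  | proc m =>
    refine ⟨⟨hlive m.castSucc (Fintype.card V) rfl, fun i hi => hearlier _ hi ?_⟩,
      ⟨hτ, fun i hi => hearlier _ hi ?_⟩, hnot⟩
    · have := (σ.live m.castSucc).2.length_le_card
      simp only [phase, Fin.val_castSucc]
      omega
    · have := (σ.static m).2.length_le_card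
      simp only [phase]
      omega

theorem finished_shareService {t : ℕ}
    (h : (k : ℝ) ≤ q * t - ((N.len c + 1) * (Fintype.card V + 1) * (1 + q) + 1)) :
    Finished N c σ (N.shareService c σ q k) t := by
  intro o ho
  rw [done_shareService_iff hq ho]
  refine unitRamp_of_one_le ?_
  have h₁ : (phase V o : ℝ) ≤ (N.len c + 1) * (Fintype.card V + 1) := by
    exact_mod_cast phase_le ho
  have := mul_le_mul_of_nonneg_right h₁ (show 0 ≤ 1 + q by positivity)
  linarith

end Request

end EdgeCloud

namespace EdgeCloud

variable {V K Φ Cl : Type} [Fintype V] [Fintype K] [Fintype Cl] (N : EdgeCloud V K Φ Cl)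

open Classical in
/-- The number of requests of client `c` in slot `t` that are delivered by `σ`, when all requests
of client `c` in slot `t` get the route `g t c`. -/
noncomputable def routeArrivals (arr : ℕ → Cl → ℕ) (g : ℕ → (c : Cl) → Route V (N.len c)) (c : Cl)
    (σ : Route V (N.len c)) (t : ℕ) : ℕ :=
  if g t c = σ then arr t c else 0

/-- The run in which every route `σ` of every client `c` is a separate fluid of rate `q c σ`, of
which the requests on this route get unit shares upon arrival. -/
noncomputable def reservationRun (q : (c : Cl) → Route V (N.len c) → ℝ) (arr : ℕ → Cl → ℕ)
    (place : ℕ → N.Placement) (g : ℕ → (c : Cl) → Route V (N.len c)) : N.Run where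
  arr := arr
  place := place
  route c τ _ := g τ c
  serve c τ n := N.shareService c (g τ c) (q c (g τ c))
    (reservation (q c (g τ c)) (N.routeArrivals arr g c (g τ c)) τ n)

variable {N} {q : (c : Cl) → Route V (N.len c) → ℝ} {arr : ℕ → Cl → ℕ}
  {place : ℕ → N.Placement} {g : ℕ → (c : Cl) → Route V (N.len c)}

theorem sumReq_reservationRun (t : ℕ) (F : (c : Cl) → Route V (N.len c) → ℕ → ℕ → ℝ) :
    ((N.reservationRun q arr place g).sumReq t fun c τ n => F c (g τ c) τ n) =
      ∑ c, ∑ σ, ∑ τ ∈ Finset.range t, ∑ n ∈ Finset.range (N.routeArrivals arr g c σ τ),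
        F c σ τ n := by
  refine Finset.sum_congr rfl fun c _ => ?_
  rw [Finset.sum_comm]
  refine Finset.sum_congr rfl fun τ _ => ?_
  rw [Finset.sum_eq_single (g τ c)]
  · simp [routeArrivals, reservationRun]
  · intro σ _ hne
    simp [routeArrivals, hne.symm]
  · simp

theorem sumReq_serve_reservationRun_le (hq : ∀ c σ, 0 ≤ q c σ)
    (ops : (c : Cl) → Route V (N.len c) → Finset (Operation (N.len c))) (t : ℕ) :
    ((N.reservationRun q arr place g).sumReq t fun c τ n =>
      ∑ o ∈ ops c (g τ c), (N.reservationRun q arr place g).serve c τ n o t) ≤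
      ∑ c, ∑ σ, q c σ * ∑ o ∈ ops c σ, N.work c o := by
  rw [show ((N.reservationRun q arr place g).sumReq t fun c τ n =>
      ∑ o ∈ ops c (g τ c), (N.reservationRun q arr place g).serve c τ n o t) = _ from
    sumReq_reservationRun t fun c σ τ n => ∑ o ∈ ops c σ,
      N.shareService c σ (q c σ) (reservation (q c σ) (N.routeArrivals arr g c σ) τ n) o t]
  refine Finset.sum_le_sum fun c _ => Finset.sum_le_sum fun σ _ => ?_
  rw [Finset.sum_sigma', Finset.sum_comm, Finset.mul_sum]
  refine Finset.sum_le_sum fun o _ => ?_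
  have h := sum_unitRamp_sub_le (reservation_injOn (q c σ) (N.routeArrivals arr g c σ) t)
    (y := q c σ * t - phase V o * (1 + q c σ)) (z := q c σ * (t + 1) - phase V o * (1 + q c σ))
    (by nlinarith [hq c σ])
  calc _ ≤ ∑ x ∈ (Finset.range t).sigma fun τ => Finset.range (N.routeArrivals arr g c σ τ),
        N.work c o * (unitRamp (q c σ * (t + 1) - phase V o * (1 + q c σ) -
            reservation (q c σ) (N.routeArrivals arr g c σ) x.1 x.2) -
          unitRamp (q c σ * t - phase V o * (1 + q c σ) -
            reservation (q c σ) (N.routeArrivals arr g c σ) x.1 x.2)) := by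
        refine Finset.sum_le_sum fun x _ => ?_
        have h₀ := progress_mono (hq c σ)
          (reservation (q c σ) (N.routeArrivals arr g c σ) x.1 x.2) (phase V o) (Nat.le_succ t)
        simp only [progress, Nat.succ_eq_add_one, Nat.cast_add, Nat.cast_one] at h₀
        unfold shareService
        split_ifs
        · simp [progress]
        · exact mul_nonneg (N.work_pos c o).le (sub_nonneg.2 h₀)
    _ ≤ q c σ * N.work c o := by
        rw [← Finset.mul_sum, mul_comm]
        exact mul_le_mul_of_nonneg_right (h.trans_eq (by ring)) (N.work_pos c o).le

/-- The reservation run respects the capacities as soon as the fluids do. -/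
theorem admissible_reservationRun (hq : ∀ c σ, 0 ≤ q c σ)
    (hroute : ∀ c τ, 0 < arr τ c → N.IsEfficientRoute c (place τ) (g τ c))
    (hnode : ∀ i, ∑ c, ∑ σ, q c σ * N.nodeLoad c σ i ≤ N.procCap i)
    (hlink : ∀ i j, N.graph.Adj i j → ∑ c, ∑ σ, q c σ * N.linkLoad c σ i j ≤ N.linkCap i j) :
    (N.reservationRun q arr place g).Admissible where
  route_mem c τ n hn := hroute c τ (Nat.zero_lt_of_lt hn)
  serve_nonneg c τ n o t := shareService_nonneg (hq _ _) o t
  serve_queued c τ n o t h :=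
    pending_of_shareService_ne_zero (hq _ _) (le_reservation _ _ τ n) h
  node_cap i t := by
    rw [Run.nodeUse_eq_sumReq]
    refine (sumReq_serve_reservationRun_le hq (fun c σ => σ.nodeOps i) t).trans ?_
    simpa only [nodeLoad_eq_sum] using hnode i
  link_cap i j t hij := by
    rw [Run.linkUse_eq_sumReq]
    refine (sumReq_serve_reservationRun_le hq (fun c σ => σ.linkOps i j) t).trans ?_
    simpa only [linkLoad_eq_sum] using hlink i j hij

theorem rateStable_reservationRun (hq : ∀ c σ, 0 ≤ q c σ)
    (harr : ∀ c σ, Tendsto (fun t : ℕ =>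
      (∑ u ∈ Finset.range t, (N.routeArrivals arr g c σ u : ℝ)) / t) atTop (𝓝 (q c σ))) :
    (N.reservationRun q arr place g).RateStable := by
  classical
  let late : (c : Cl) → Route V (N.len c) → ℕ → ℕ → ℕ → Prop := fun c σ t τ n =>
    ¬ Finished N c σ (N.shareService c σ (q c σ)
      (reservation (q c σ) (N.routeArrivals arr g c σ) τ n)) t
  have hlim : Tendsto (fun t : ℕ => ∑ c, ∑ σ, N.maxBacklog c σ * (1 / (t : ℝ) *
      ∑ τ ∈ Finset.range t, ∑ n ∈ Finset.range (N.routeArrivals arr g c σ τ),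
        if late c σ t τ n then (1 : ℝ) else 0)) atTop (𝓝 0) := by
    have hroute : ∀ c σ, Tendsto (fun t : ℕ => N.maxBacklog c σ * (1 / (t : ℝ) *
        ∑ τ ∈ Finset.range t, ∑ n ∈ Finset.range (N.routeArrivals arr g c σ τ),
          if late c σ t τ n then (1 : ℝ) else 0)) atTop (𝓝 0) := by
      intro c σ
      have hq' := hq c σ
      have hlate : ∀ t τ n, τ < t → late c σ t τ n →
          q c σ * t - ((N.len c + 1) * (Fintype.card V + 1) * (1 + q c σ) + 1) ≤
            reservation (q c σ) (N.routeArrivals arr g c σ) τ n := by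
        intro t τ n _ hl
        by_contra! hc
        exact hl (finished_shareService hq' hc.le)
      have h0 : 0 ≤ (N.len c + 1) * (Fintype.card V + 1) * (1 + q c σ) + 1 := by positivity
      have h := (tendsto_card_reservation_gt hq' (harr c σ) h0 hlate).const_mul
        (N.maxBacklog c σ)
      rwa [mul_zero] at h
    have h := tendsto_finsetSum Finset.univ fun c _ =>
      tendsto_finsetSum Finset.univ fun σ _ => hroute c σ
    simpa only [Finset.sum_const_zero] using h
  refine squeeze_zero (fun t => ?_) (fun t => ?_) hlim
  · rw [Run.backlog_eq_sumReq]
    exact mul_nonneg (by positivity) (Finset.sum_nonneg fun _ _ => Finset.sum_nonneg fun _ _ =>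
      Finset.sum_nonneg fun _ _ => N.requestBacklog_nonneg ..)
  · rw [Run.backlog_eq_sumReq]
    have h : ((N.reservationRun q arr place g).sumReq t fun c τ n =>
        N.requestBacklog c ((N.reservationRun q arr place g).route c τ n) τ
          ((N.reservationRun q arr place g).serve c τ n) t) ≤
        (N.reservationRun q arr place g).sumReq t fun c τ n => N.maxBacklog c (g τ c) *
          if late c (g τ c) t τ n then (1 : ℝ) else 0 := by
      refine Run.sumReq_mono _ fun c τ n hτ _ => ?_
      split_ifs with hl
      · rw [mul_one]
        exact N.requestBacklog_le_maxBacklog ..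
      · rw [mul_zero]
        exact (requestBacklog_of_finished hτ (not_not.1 hl)).le
    refine (mul_le_mul_of_nonneg_left h (by positivity)).trans_eq ?_
    rw [sumReq_reservationRun t fun c σ τ n =>
      N.maxBacklog c σ * if late c σ t τ n then (1 : ℝ) else 0]
    simp only [Finset.mul_sum]
    refine Finset.sum_congr rfl fun c _ => Finset.sum_congr rfl fun σ _ =>
      Finset.sum_congr rfl fun τ _ => Finset.sum_congr rfl fun n _ => ?_
    ring

end EdgeCloud

/-! ### Randomized routing of random arrivals -/

namespace EdgeCloud

section ArrivalLaw

variable {Cl : Type} {lam : Cl → ℝ≥0} {ν : Measure (Cl → ℕ)}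

theorem IsArrivalLaw.integrable (hν : IsArrivalLaw lam ν) (c : Cl) :
    Integrable (fun v => (v c : ℝ)) ν := by
  have := hν.1
  obtain ⟨A, hA⟩ := hν.2.1
  refine Integrable.of_bound (C := A c)
    (Measurable.aestronglyMeasurable (by fun_prop)) ?_
  filter_upwards [hA] with v hv
  simpa using hv c

theorem IsArrivalLaw.ae_eq_zero (hν : IsArrivalLaw lam ν) {c : Cl} (hc : lam c = 0) :
    ∀ᵐ v ∂ν, v c = 0 := by
  have h := hν.2.2 c
  rw [hc, NNReal.coe_zero, integral_eq_zero_iff_of_nonneg (fun v => Nat.cast_nonneg _)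
    (hν.integrable c)] at h
  filter_upwards [h] with v hv
  simpa using hv

end ArrivalLaw

section SlotNoise

variable {Cl Z : Type} [MeasurableSpace Z]

/-- The sample space: coordinate `(t, true)` determines the arrivals of slot `t`, and coordinate
`(t, false)` the random decision for slot `t`. -/
abbrev SlotNoise (Cl Z : Type) : Type := ℕ × Bool → (Cl → ℕ) × Z

/-- Before slot `t`, all decisions and the arrivals of the earlier slots are known. -/
def slotFiltration (Cl Z : Type) [MeasurableSpace Z] :
    Filtration ℕ (inferInstance : MeasurableSpace (SlotNoise Cl Z)) where
  seq t := ⨆ i ∈ {i : ℕ × Bool | i.2 = true → i.1 < t},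
    MeasurableSpace.comap (fun ω : SlotNoise Cl Z => ω i) inferInstance
  mono' _ _ hst := biSup_mono fun _ hi h => (hi h).trans_le hst
  le' _ := iSup₂_le fun i _ => (measurable_pi_apply i).comap_le

theorem measurable_slotFiltration {t : ℕ} {i : ℕ × Bool} (hi : i.2 = true → i.1 < t) :
    Measurable[slotFiltration Cl Z t] fun ω : SlotNoise Cl Z => ω i :=
  (comap_measurable _).mono
    (le_iSup₂ (f := fun (i : ℕ × Bool) (_ : i ∈ {i : ℕ × Bool | i.2 = true → i.1 < t}) =>
      MeasurableSpace.comap (fun ω : SlotNoise Cl Z => ω i) inferInstance) i hi) le_rfl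

variable {lam : Cl → ℝ≥0} {ν : Measure (Cl → ℕ)} {κ : Measure Z} [IsProbabilityMeasure κ]
  [IsProbabilityMeasure ν]

theorem measurePreserving_arrival (i : ℕ × Bool) : MeasurePreserving
    (fun ω : SlotNoise Cl Z => (ω i).1) (Measure.infinitePi fun _ => ν.prod κ) ν :=
  measurePreserving_fst.comp (measurePreserving_eval_infinitePi _ i)

theorem measurePreserving_decision (i : ℕ × Bool) : MeasurePreserving
    (fun ω : SlotNoise Cl Z => (ω i).2) (Measure.infinitePi fun _ => ν.prod κ) κ :=
  measurePreserving_snd.comp (measurePreserving_eval_infinitePi _ i)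

theorem indep_slotFiltration (t : ℕ) :
    Indep (MeasurableSpace.comap (fun ω : SlotNoise Cl Z => (ω (t, true)).1) inferInstance)
      (slotFiltration Cl Z t) (Measure.infinitePi fun _ => ν.prod κ) := by
  have hind : iIndepFun (fun (i : ℕ × Bool) (ω : SlotNoise Cl Z) => ω i)
      (Measure.infinitePi fun _ => ν.prod κ) :=
    iIndepFun_infinitePi (X := fun _ e => e) fun _ => measurable_id
  have h := indep_iSup_of_disjoint (fun i => (measurable_pi_apply i).comap_le) hind.iIndep
    (S := {(t, true)}) (T := {i : ℕ × Bool | i.2 = true → i.1 < t}) (by simp)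
  refine indep_of_indep_of_le_left h ?_
  rw [iSup_singleton]
  exact (measurable_fst.comp (comap_measurable _)).comap_le

/-- Strong law of large numbers for the arrivals in those slots whose decision lies in a given
set. -/
theorem ae_tendsto_sum_arrivals (hν : IsArrivalLaw lam ν) (c : Cl) {B : Set Z}
    (hB : MeasurableSet B) :
    ∀ᵐ ω ∂(Measure.infinitePi fun _ => ν.prod κ : Measure (SlotNoise Cl Z)),
      Tendsto (fun t : ℕ => (∑ u ∈ Finset.range t,
        ((ω (u, true)).1 c : ℝ) * B.indicator 1 (ω (u, false)).2) / t) atTop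
        (𝓝 (lam c * κ.real B)) := by
  set P : Measure (SlotNoise Cl Z) := Measure.infinitePi fun _ => ν.prod κ
  set F : ((Cl → ℕ) × Z) × ((Cl → ℕ) × Z) → ℝ := fun e => (e.1.1 c : ℝ) * B.indicator 1 e.2.2
  have hF : Measurable F := by
    have h₁ : Measurable (B.indicator (1 : Z → ℝ)) := measurable_one.indicator hB
    have h₂ : Measurable fun e : ((Cl → ℕ) × Z) × ((Cl → ℕ) × Z) => (e.1.1 c : ℝ) := by
      fun_prop
    exact h₂.mul (h₁.comp (measurable_snd.comp measurable_snd))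
  have hpair : ∀ u : ℕ, Measurable fun ω : SlotNoise Cl Z => (ω (u, true), ω (u, false)) :=
    fun u => by fun_prop
  have hlaw : ∀ u : ℕ, P.map (fun ω => (ω (u, true), ω (u, false))) =
      (ν.prod κ).prod (ν.prod κ) := fun u => Measure.infinitePi_map_eval_prod (by simp)
  have hind : iIndepFun (fun (i : ℕ × Bool) (ω : SlotNoise Cl Z) => ω i) P :=
    iIndepFun_infinitePi (X := fun _ e => e) fun _ => measurable_id
  have hmean : ∫ ω, F (ω (0, true), ω (0, false)) ∂P = lam c * κ.real B := by
    rw [← integral_map (f := F) (hpair 0).aemeasurable hF.aestronglyMeasurable, hlaw 0]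
    rw [integral_prod_mul (fun e : (Cl → ℕ) × Z => (e.1 c : ℝ))
      (fun e : (Cl → ℕ) × Z => B.indicator 1 e.2)]
    rw [integral_fun_fst (f := fun v : Cl → ℕ => (v c : ℝ)),
      integral_fun_snd (f := fun z => B.indicator (1 : Z → ℝ) z), integral_indicator_one hB,
      hν.2.2 c]
    simp
  have hslln := strong_law_ae_real (μ := P) (fun u ω => F (ω (u, true), ω (u, false))) ?_ ?_ ?_
  · rw [hmean] at hslln
    exact hslln
  · obtain ⟨A, hA⟩ := hν.2.1
    refine Integrable.of_bound (C := A c) (hF.comp (hpair 0)).aestronglyMeasurable ?_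
    filter_upwards [(measurePreserving_arrival (0, true)).quasiMeasurePreserving.ae hA] with ω hω
    have h₁ : ((ω (0, true)).1 c : ℝ) ≤ A c := by exact_mod_cast hω c
    by_cases hz : (ω (0, false)).2 ∈ B <;> simp [F, hz, h₁]
  · intro u v huv
    exact (hind.indepFun_prodMk_prodMk measurable_pi_apply _ _ _ _ (by simpa using huv)
      (by simp) (by simp) (by simpa using huv)).comp hF hF
  · intro u
    exact IdentDistrib.comp ⟨(hpair u).aemeasurable, (hpair 0).aemeasurable,
      (hlaw u).trans (hlaw 0).symm⟩ hF

end SlotNoise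

section StaticPolicy

variable {V K Φ Cl : Type} [Fintype V] [Fintype K] [Fintype Cl] (N : EdgeCloud V K Φ Cl)
  {Z : Type} [Countable Z] [MeasurableSpace Z] [DiscreteMeasurableSpace Z]

/-- The policy that draws placement and routes of every slot independently of everything else,
and serves by reservation. -/
noncomputable def staticPolicy (q : (c : Cl) → Route V (N.len c) → ℝ) (hq : ∀ c σ, 0 ≤ q c σ)
    (x : Z → N.Placement) (g : Z → (c : Cl) → Route V (N.len c)) (ν : Measure (Cl → ℕ))
    [IsProbabilityMeasure ν] (κ : Measure Z) [IsProbabilityMeasure κ] :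
    ControlledProcess N ν (Measure.infinitePi fun _ => ν.prod κ : Measure (SlotNoise Cl Z))
      (slotFiltration Cl Z) where
  run ω := N.reservationRun q (fun t => (ω (t, true)).1) (fun t => x (ω (t, false)).2)
    (fun t => g (ω (t, false)).2)
  arr_meas t := measurable_fst.comp (measurable_slotFiltration fun _ => Nat.lt_succ_self t)
  arr_law t := (measurePreserving_arrival (t, true)).map_eq
  arr_indep t := indep_slotFiltration t
  place_meas t y := (measurable_snd.comp (measurable_slotFiltration (i := (t, false)) (by simp)))
    (MeasurableSet.of_discrete (s := {z | x z = y}))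
  route_meas c t _ σ :=
    (measurable_snd.comp (measurable_slotFiltration (i := (t, false)) (by simp)))
      (MeasurableSet.of_discrete (s := {z | g z c = σ}))
  serve_meas c τ n o t := by
    rcases lt_or_ge τ t with hτ | hτ
    · -- The service is a function of the finitely many discrete coordinates of slots up to `τ`.
      let past : SlotNoise Cl Z → Fin (τ + 1) → (Cl → ℕ) × Z :=
        fun ω u => ((ω (u, true)).1, (ω (u, false)).2)
      let ext : (Fin (τ + 1) → (Cl → ℕ) × Z) → ℕ → (Cl → ℕ) × Z :=
        fun w u => w ⟨min u τ, by omega⟩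
      have hpast : Measurable[slotFiltration Cl Z (t + 1)] past := by
        refine @measurable_pi_lambda _ _ _ (slotFiltration Cl Z (t + 1)) _ _ fun u => ?_
        refine Measurable.prodMk ?_ ?_
        · exact measurable_fst.comp (measurable_slotFiltration fun _ => by
            have := u.2
            dsimp only
            omega)
        · exact measurable_snd.comp (measurable_slotFiltration (by simp))
      have hserve := (Measurable.of_discrete (f := fun w : Fin (τ + 1) → (Cl → ℕ) × Z =>
        (N.reservationRun q (fun t => (ext w t).1) (fun t => x (ext w t).2)
          (fun t => g (ext w t).2)).serve c τ n o t)).comp hpast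
      convert hserve using 1
      funext ω
      have hext : ∀ u ≤ τ, ext (past ω) u = ((ω (u, true)).1, (ω (u, false)).2) := by
        intro u hu
        simp only [ext, past, min_eq_left hu]
      simp only [Function.comp_apply, reservationRun, hext τ le_rfl]
      congr 1
      refine reservation_congr (fun u hu => ?_) n
      rw [routeArrivals, routeArrivals, hext u hu.le]
    · convert @measurable_const ℝ (SlotNoise Cl Z) _ (slotFiltration Cl Z (t + 1)) 0 using 1
      funext ω
      by_contra hne
      exact absurd (pending_of_shareService_ne_zero (hq _ _) (le_reservation _ _ τ n) hne).arrived
        (not_lt.2 hτ)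

variable {N} in
/-- Random placements and routes stabilize the network whenever the mean loads respect the
capacities: almost surely, the arrivals on every route have their mean rate. -/
theorem stabilizable_of_static {lam : Cl → ℝ≥0} {ν : Measure (Cl → ℕ)} (hν : IsArrivalLaw lam ν)
    (κ : Measure Z) [IsProbabilityMeasure κ] (x : Z → N.Placement)
    (g : Z → (c : Cl) → Route V (N.len c))
    (heff : ∀ᵐ z ∂κ, ∀ c, 0 < lam c → N.IsEfficientRoute c (x z) (g z c))
    (hnode : ∀ i, ∑ c, ∑ σ, lam c * κ.real {z | g z c = σ} * N.nodeLoad c σ i ≤ N.procCap i)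
    (hlink : ∀ i j, N.graph.Adj i j →
      ∑ c, ∑ σ, lam c * κ.real {z | g z c = σ} * N.linkLoad c σ i j ≤ N.linkCap i j) :
    N.Stabilizable ν := by
  have := hν.1
  set q : (c : Cl) → Route V (N.len c) → ℝ := fun c σ => lam c * κ.real {z | g z c = σ}
  have hq : ∀ c σ, 0 ≤ q c σ := fun c σ => by positivity
  refine ⟨SlotNoise Cl Z, inferInstance, _, _, N.staticPolicy q hq x g ν κ, inferInstance, ?_⟩
  have hslln := ae_all_iff.2 fun c => ae_all_iff.2 fun σ => ae_tendsto_sum_arrivals (κ := κ) hν c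
    (MeasurableSet.of_discrete (s := {z | g z c = σ}))
  have heff' := ae_all_iff.2 fun t : ℕ =>
    (measurePreserving_decision (ν := ν) (κ := κ) (t, false)).quasiMeasurePreserving.ae heff
  have hzero : ∀ᵐ v ∂ν, ∀ c, lam c = 0 → v c = 0 := by
    refine ae_all_iff.2 fun c => ?_
    by_cases hc : lam c = 0
    · filter_upwards [hν.ae_eq_zero hc] with v hv _ using hv
    · exact Eventually.of_forall fun v h => absurd h hc
  have hzero' := ae_all_iff.2 fun t : ℕ =>
    (measurePreserving_arrival (ν := ν) (κ := κ) (t, true)).quasiMeasurePreserving.ae hzero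
  filter_upwards [hslln, heff', hzero'] with ω h₁ h₂ h₃
  refine ⟨admissible_reservationRun hq (fun c τ ha => h₂ τ c ?_) hnode hlink,
    rateStable_reservationRun hq fun c σ => ?_⟩
  · exact pos_iff_ne_zero.2 fun h0 => ha.ne' (h₃ τ c h0)
  · refine (h₁ c σ).congr fun t => ?_
    congr 1
    refine Finset.sum_congr rfl fun u _ => ?_
    by_cases hu : g (ω (u, false)).2 c = σ <;> simp [routeArrivals, hu]

end StaticPolicy

end EdgeCloud

/-! ### Realizing a capacity solution by a randomized policy -/

theorem exists_isProbabilityMeasure_real_eq_sum {Z : Type} [Fintype Z] [MeasurableSpace Z]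
    [DiscreteMeasurableSpace Z] {w : Z → ℝ} (hw : ∀ z, 0 ≤ w z) (hsum : ∑ z, w z = 1) :
    ∃ κ : Measure Z, IsProbabilityMeasure κ ∧ ∀ B : Set Z, κ.real B = ∑ z, B.indicator w z := by
  have hone : ∑ z, ENNReal.ofReal (w z) = 1 := by
    rw [← ENNReal.ofReal_sum_of_nonneg fun z _ => hw z, hsum, ENNReal.ofReal_one]
  refine ⟨(PMF.ofFintype _ hone).toMeasure, inferInstance, fun B => ?_⟩
  rw [measureReal_def, PMF.toMeasure_apply_fintype,
    ENNReal.toReal_sum]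
  · refine Finset.sum_congr rfl fun z _ => ?_
    by_cases hz : z ∈ B <;> simp [hz, hw z]
  · intro z _
    by_cases hz : z ∈ B <;> simp [hz]

/-- The marginals of a product distribution on a finite product. -/
theorem sum_ite_prod_eq {ι : Type*} [Fintype ι] [DecidableEq ι] {X : ι → Type*}
    [∀ i, Fintype (X i)] [∀ i, DecidableEq (X i)] {p : (i : ι) → X i → ℝ}
    (hp : ∀ i, ∑ b, p i b = 1) (i : ι) (a : X i) :
    ∑ g : (j : ι) → X j, (if g i = a then ∏ j, p j (g j) else 0) = p i a := by
  set f : (j : ι) → X j → ℝ := Function.update p i fun b => if b = a then p i b else 0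
  have hf : ∀ g : (j : ι) → X j, (if g i = a then ∏ j, p j (g j) else 0) = ∏ j, f j (g j) := by
    intro g
    split_ifs with h
    · refine Finset.prod_congr rfl fun j _ => ?_
      by_cases hj : j = i
      · subst hj
        simp [f, h]
      · simp [f, Function.update_of_ne hj]
    · exact (Finset.prod_eq_zero (Finset.mem_univ i) (by simp [f, h])).symm
  simp only [hf]
  rw [← Fintype.piFinset_univ, ← Finset.prod_univ_sum, Fintype.prod_eq_single i]
  · simp [f]
  · intro j hj
    simp [f, Function.update_of_ne hj, hp]

theorem sum_prod_eq_one {ι : Type*} [Fintype ι] [DecidableEq ι] {X : ι → Type*}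
    [∀ i, Fintype (X i)] {p : (i : ι) → X i → ℝ} (hp : ∀ i, ∑ b, p i b = 1) :
    ∑ g : (j : ι) → X j, ∏ j, p j (g j) = 1 := by
  rw [← Fintype.piFinset_univ, ← Finset.prod_univ_sum]
  simp [hp]

namespace EdgeCloud

variable {V K Φ Cl : Type} [Fintype V] [Fintype K] [Fintype Cl] {N : EdgeCloud V K Φ Cl}

theorem stabilizable_of_satisfiesCapacity {lam : Cl → ℝ≥0} {ν : Measure (Cl → ℕ)}
    (hν : IsArrivalLaw lam ν) (h : N.SatisfiesCapacity lam) : N.Stabilizable ν := by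
  classical
  obtain ⟨P, Q, hP, hP1, hQ, hQ1, hnode, hlink⟩ := h
  let r₀ : (c : Cl) → Route V (N.len c) := fun c =>
    ⟨fun _ => N.source c, fun _ => ⟨[], List.nodup_nil⟩, fun _ => ⟨[], List.nodup_nil⟩⟩
  -- Clients without requests, and all clients under an unused placement, may have no efficient
  -- route; there the route is arbitrary.
  let p : (x : N.Placement) → (c : Cl) → Route V (N.len c) → ℝ := fun x c σ =>
    if 0 < P x ∧ 0 < lam c then
      if hσ : N.IsEfficientRoute c x σ then Q x c ⟨σ, hσ⟩ else 0
    else if σ = r₀ c then 1 else 0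
  have hsub : ∀ x c, 0 < P x → 0 < lam c → ∀ f : Route V (N.len c) → ℝ,
      ∑ σ, p x c σ * f σ = ∑ σ : N.EfficientRoute c x, f σ.1 * Q x c σ := by
    intro x c hx hc f
    refine (Fintype.sum_of_injective (fun σ : N.EfficientRoute c x => σ.1)
      Subtype.val_injective _ _ (fun σ hσ => ?_) fun σ => ?_).symm
    · have hσ' : ¬ N.IsEfficientRoute c x σ := fun h => hσ ⟨⟨σ, h⟩, rfl⟩
      simp [p, hx, hc, hσ']
    · have hσ : N.IsEfficientRoute c x σ.1 := σ.2
      simp only [p, hx, hc, hσ, and_self, if_true, dif_pos]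
      exact mul_comm _ _
  have hp0 : ∀ x c σ, 0 ≤ p x c σ := by
    intro x c σ
    simp only [p]
    split_ifs
    exacts [hQ _ _ _, le_rfl, zero_le_one, le_rfl]
  have hp1 : ∀ x c, ∑ σ, p x c σ = 1 := by
    intro x c
    by_cases hxc : 0 < P x ∧ 0 < lam c
    · have := hsub x c hxc.1 hxc.2 fun _ => 1
      simpa [hQ1 x c hxc.1 hxc.2] using this
    · simp [p, hxc]
  let Z := N.Placement × ((c : Cl) → Route V (N.len c))
  let _ : MeasurableSpace Z := ⊤
  have : DiscreteMeasurableSpace Z := ⟨fun _ => trivial⟩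
  let w : Z → ℝ := fun z => P z.1 * ∏ c, p z.1 c (z.2 c)
  have hw : ∀ z, 0 ≤ w z := fun z => mul_nonneg (hP _) (Finset.prod_nonneg fun c _ => hp0 _ _ _)
  have hw1 : ∑ z, w z = 1 := by
    rw [Fintype.sum_prod_type]
    simp only [w, ← Finset.mul_sum, sum_prod_eq_one (hp1 _), mul_one, hP1]
  obtain ⟨κ, hκ, hκw⟩ := exists_isProbabilityMeasure_real_eq_sum hw hw1
  have hmarg : ∀ c σ, κ.real {z | z.2 c = σ} = ∑ x, P x * p x c σ := by
    intro c σ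
    rw [hκw, Fintype.sum_prod_type]
    refine Finset.sum_congr rfl fun x _ => ?_
    rw [← sum_ite_prod_eq (hp1 x) c σ, Finset.mul_sum]
    refine Finset.sum_congr rfl fun g _ => ?_
    by_cases hg : g c = σ <;> simp [w, hg]
  have hload : ∀ f : (c : Cl) → Route V (N.len c) → ℝ,
      ∑ c, ∑ σ, lam c * κ.real {z | z.2 c = σ} * f c σ =
        ∑ x, P x * ∑ c, (lam c : ℝ) * ∑ σ : N.EfficientRoute c x, f c σ.1 * Q x c σ := by
    intro f
    have h₁ : ∀ x c, P x * ((lam c : ℝ) * ∑ σ : N.EfficientRoute c x, f c σ.1 * Q x c σ) =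
        P x * ((lam c : ℝ) * ∑ σ, p x c σ * f c σ) := by
      intro x c
      rcases (hP x).eq_or_lt with hx | hx
      · simp [← hx]
      rcases (zero_le : 0 ≤ lam c).eq_or_lt with hc | hc
      · simp [← hc]
      rw [hsub x c hx hc]
    simp only [Finset.mul_sum (s := Finset.univ) (ι := Cl), h₁, hmarg]
    rw [Finset.sum_comm]
    refine Finset.sum_congr rfl fun c _ => ?_
    simp only [Finset.mul_sum, Finset.sum_mul]
    rw [Finset.sum_comm]
    refine Finset.sum_congr rfl fun x _ => Finset.sum_congr rfl fun σ _ => ?_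
    ring
  refine stabilizable_of_static hν κ (fun z => z.1) (fun z => z.2) ?_ (fun i => ?_)
    fun i j hij => ?_
  · rw [ae_iff, ← measureReal_eq_zero_iff, hκw]
    refine Finset.sum_eq_zero fun z _ => Set.indicator_apply_eq_zero.2 fun hz => ?_
    by_contra hwz
    apply hz
    intro c hc
    have hx : 0 < P z.1 := (hP _).lt_of_ne' fun h0 => hwz (by simp [w, h0])
    by_contra hne
    exact hwz (mul_eq_zero_of_right _ (Finset.prod_eq_zero (Finset.mem_univ c)
      (by simp [p, hx, hc, hne])))
  · exact (hload fun c σ => N.nodeLoad c σ i).trans_le (hnode i)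
  · exact (hload fun c σ => N.linkLoad c σ i j).trans_le (hlink i j hij)

end EdgeCloud

/-! ### Necessity of the capacity conditions -/

namespace EdgeCloud

variable {V K Φ Cl : Type}

theorem exists_pos_le_liveSize [Finite Cl] (N : EdgeCloud V K Φ Cl) :
    ∃ δ : ℝ, 0 < δ ∧ ∀ c m, δ ≤ N.liveSize c m := by
  classical
  rcases isEmpty_or_nonempty (Σ c : Cl, Fin (N.len c + 1)) with h | h
  · exact ⟨1, one_pos, fun c m => h.elim ⟨c, m⟩⟩
  · obtain ⟨p, hp⟩ := Finite.exists_min fun p : Σ c : Cl, Fin (N.len c + 1) => N.liveSize p.1 p.2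
    exact ⟨_, N.liveSize_pos p.1 p.2, fun c m => hp ⟨c, m⟩⟩

variable [Fintype K] {N : EdgeCloud V K Φ Cl}

namespace Run

variable [Fintype Cl] {R : N.Run}

theorem sumReq_eq_of_le {t T : ℕ} (h : t ≤ T) {f : Cl → ℕ → ℕ → ℝ}
    (hf : ∀ c τ n, t ≤ τ → f c τ n = 0) : R.sumReq T f = R.sumReq t f := by
  refine Finset.sum_congr rfl fun c _ => ?_
  refine (Finset.sum_subset (Finset.range_mono h) fun τ _ hτ => ?_).symm
  exact Finset.sum_eq_zero fun n _ => hf c τ n (by simpa using hτ)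

/-- The work that the requests put on a resource has been done by that resource, except for
the requests that are not finished, and these show up in the backlog. -/
theorem sumReq_work_le [Fintype V] (hR : R.Admissible)
    {ops : (c : Cl) → Route V (N.len c) → Finset (Operation (N.len c))}
    (hops : ∀ c σ, ∀ o ∈ ops c σ, σ.HasOp o) {cap : ℝ}
    (hcap : ∀ t, (R.sumReq t fun c τ n => ∑ o ∈ ops c (R.route c τ n), R.serve c τ n o t) ≤ cap)
    {W δ : ℝ} (hW : ∀ c σ, ∑ o ∈ ops c σ, N.work c o ≤ W) (hW0 : 0 ≤ W) (hδ : 0 < δ)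
    (hδN : ∀ c m, δ ≤ N.liveSize c m) (T : ℕ) :
    (R.sumReq T fun c τ n => ∑ o ∈ ops c (R.route c τ n), N.work c o) ≤
      T * cap + W / δ * R.backlog T := by
  have hserved : (R.sumReq T fun c τ n => ∑ u ∈ Finset.range T,
      ∑ o ∈ ops c (R.route c τ n), R.serve c τ n o u) ≤ T * cap := by
    rw [sumReq_finset_sum (f := fun u c τ n => ∑ o ∈ ops c (R.route c τ n), R.serve c τ n o u)]
    refine (Finset.sum_le_card_nsmul _ _ cap fun u hu => ?_).trans_eq (by simp)
    rw [sumReq_eq_of_le (Finset.mem_range.1 hu).le]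
    · exact hcap u
    · intro c τ n hτ
      refine Finset.sum_eq_zero fun o _ => ?_
      by_contra hne
      exact absurd (Pending.arrived (hR.serve_queued c τ n o u hne)) (not_lt.2 hτ)
  have hle : (R.sumReq T fun c τ n => ∑ o ∈ ops c (R.route c τ n), N.work c o) ≤
      R.sumReq T fun c τ n => (∑ u ∈ Finset.range T,
        ∑ o ∈ ops c (R.route c τ n), R.serve c τ n o u) +
          W / δ * N.requestBacklog c (R.route c τ n) τ (R.serve c τ n) T := by
    refine sumReq_mono _ fun c τ n hτ hn => ?_
    have hB := N.requestBacklog_nonneg c (R.route c τ n) τ (R.serve c τ n) T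
    by_cases hf : Finished N c (R.route c τ n) (R.serve c τ n) T
    · refine le_add_of_le_of_nonneg ?_ (by positivity)
      rw [Finset.sum_comm]
      exact Finset.sum_le_sum fun o ho => hf o (hops c _ o ho)
    · have h := le_requestBacklog_of_not_finished (hR.route_mem c τ n hn) (hδN c) hτ hf
      refine le_add_of_nonneg_of_le (Finset.sum_nonneg fun u _ => Finset.sum_nonneg fun o _ =>
        hR.serve_nonneg c τ n o u) ((hW c _).trans ?_)
      calc W = W / δ * δ := by field_simp
        _ ≤ _ := by gcongr
  refine hle.trans ?_
  rw [sumReq_add, sumReq_const_mul, ← backlog_eq_sumReq]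
  exact add_le_add hserved le_rfl

end Run

section Frequencies

variable {ν : Measure (Cl → ℕ)} {Ω : Type} [mΩ : MeasurableSpace Ω] {μ : Measure Ω}
  {ℱ : Filtration ℕ mΩ} (S : ControlledProcess N ν μ ℱ) (A : Cl → ℕ)

open Classical in
/-- The number of requests of client `c` in slot `t` that get the route `σ` under the placement
`x`, where only the first `A c` requests are counted. -/
noncomputable def routeCount (t : ℕ) (x : N.Placement) (c : Cl) (σ : Route V (N.len c))
    (ω : Ω) : ℝ :=
  ∑ n ∈ Finset.range (A c),
    if n < (S.run ω).arr t c ∧ (S.run ω).place t = x ∧ (S.run ω).route c t n = σ then 1 else 0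

theorem measurable_routeCount (t : ℕ) (x : N.Placement) (c : Cl) (σ : Route V (N.len c)) :
    Measurable (routeCount S A t x c σ) := by
  classical
  refine Finset.measurable_sum _ fun n _ => Measurable.ite ?_ measurable_const measurable_const
  have h₁ : MeasurableSet {ω | n < (S.run ω).arr t c} :=
    ((measurable_pi_apply c).comp ((S.arr_meas t).mono (ℱ.le _) le_rfl))
      (MeasurableSet.of_discrete (s := {k : ℕ | n < k}))
  exact h₁.inter ((ℱ.le _ _ (S.place_meas t x)).inter (ℱ.le _ _ (S.route_meas c t n σ)))

theorem routeCount_nonneg (t : ℕ) (x : N.Placement) (c : Cl) (σ : Route V (N.len c)) (ω : Ω) :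
    0 ≤ routeCount S A t x c σ ω :=
  Finset.sum_nonneg fun _ _ => by split_ifs <;> norm_num

theorem routeCount_le (t : ℕ) (x : N.Placement) (c : Cl) (σ : Route V (N.len c)) (ω : Ω) :
    routeCount S A t x c σ ω ≤ A c := by
  refine (Finset.sum_le_card_nsmul _ _ 1 fun _ _ => ?_).trans_eq (by simp)
  split_ifs <;> norm_num

theorem integrable_routeCount [IsProbabilityMeasure μ] (t : ℕ) (x : N.Placement) (c : Cl)
    (σ : Route V (N.len c)) : Integrable (routeCount S A t x c σ) μ :=
  Integrable.of_bound (measurable_routeCount S A t x c σ).aestronglyMeasurable (A c)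
    (Eventually.of_forall fun ω => by
      rw [Real.norm_of_nonneg (routeCount_nonneg ..)]
      exact routeCount_le ..)

variable [Fintype V] [Fintype Cl] {S A}

open Classical in
theorem sum_routeCount {ω : Ω} (hω : (S.run ω).Admissible) {t : ℕ} {c : Cl}
    (hA : (S.run ω).arr t c ≤ A c) (f : Route V (N.len c) → ℝ) (x : N.Placement) :
    ∑ σ : N.EfficientRoute c x, f σ.1 * routeCount S A t x c σ.1 ω =
      if (S.run ω).place t = x then
        ∑ n ∈ Finset.range ((S.run ω).arr t c), f ((S.run ω).route c t n) else 0 := by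
  simp only [routeCount, Finset.mul_sum]
  rw [Finset.sum_comm]
  by_cases hx : (S.run ω).place t = x
  · rw [if_pos hx]
    refine Eq.trans ?_ (Finset.sum_subset (Finset.range_mono hA) (f := fun n =>
      ∑ σ : N.EfficientRoute c x, f σ.1 *
        if n < (S.run ω).arr t c ∧ (S.run ω).place t = x ∧ (S.run ω).route c t n = σ.1
        then 1 else 0) fun n _ hn => ?_).symm |>.trans ?_
    · rfl
    · have hn' : ¬ n < (S.run ω).arr t c := fun h => hn (Finset.mem_range.2 h)
      exact Finset.sum_eq_zero fun σ _ => by simp [hn']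
    · refine Finset.sum_congr rfl fun n hn => ?_
      have hn' := Finset.mem_range.1 hn
      have hmem := hω.route_mem c t n hn'
      rw [hx] at hmem
      refine (Finset.sum_eq_single (⟨(S.run ω).route c t n, hmem⟩ : N.EfficientRoute c x)
        (fun σ _ hne => ?_) fun h =>
          absurd (Finset.mem_univ (α := N.EfficientRoute c x) _) h).trans ?_
      · have : (S.run ω).route c t n ≠ σ.1 := fun h => hne (Subtype.ext h.symm)
        simp [this]
      · simp [hn', hx]
  · rw [if_neg hx]
    exact Finset.sum_eq_zero fun n _ => Finset.sum_eq_zero fun σ _ => by simp [hx]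

theorem sum_sum_routeCount {ω : Ω} (hω : (S.run ω).Admissible)
    (hA : ∀ t c, (S.run ω).arr t c ≤ A c) (f : (c : Cl) → Route V (N.len c) → ℝ) (T : ℕ) :
    ∑ t ∈ Finset.range T, ∑ x, ∑ c, ∑ σ : N.EfficientRoute c x,
        f c σ.1 * routeCount S A t x c σ.1 ω =
      (S.run ω).sumReq T fun c τ n => f c ((S.run ω).route c τ n) := by
  classical
  simp only [sum_routeCount hω (hA _ _)]
  refine Eq.trans (Finset.sum_congr rfl fun t _ => ?_) Finset.sum_comm
  rw [Finset.sum_comm]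
  simp

theorem integral_sum_routeCount {lam : Cl → ℝ≥0} [IsProbabilityMeasure μ]
    (hν : IsArrivalLaw lam ν) (hadm : ∀ᵐ ω ∂μ, (S.run ω).Admissible)
    (hA : ∀ᵐ ω ∂μ, ∀ t c, (S.run ω).arr t c ≤ A c) (t : ℕ) (x : N.Placement) (c : Cl) :
    ∑ σ : N.EfficientRoute c x, ∫ ω, routeCount S A t x c σ.1 ω ∂μ =
      lam c * μ.real {ω | (S.run ω).place t = x} := by
  classical
  set E : Set Ω := {ω | (S.run ω).place t = x}
  have hE : MeasurableSet[ℱ t] E := S.place_meas t x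
  have hind' : Measurable[ℱ t] (E.indicator (1 : Ω → ℝ)) :=
    Measurable.indicator (@measurable_const _ _ _ (ℱ t) 1) hE
  have harr : Measurable fun ω => (S.run ω).arr t := (S.arr_meas t).mono (ℱ.le _) le_rfl
  have hcoord : Measurable fun v : Cl → ℕ => (v c : ℝ) := by fun_prop
  have hind : IndepFun (fun ω => ((S.run ω).arr t c : ℝ)) (E.indicator (1 : Ω → ℝ)) μ := by
    refine indep_of_indep_of_le_left (indep_of_indep_of_le_right (S.arr_indep t) ?_) ?_
    · exact hind'.comap_le
    · exact (hcoord.comp (comap_measurable _)).comap_le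
  have hmean : ∫ ω, ((S.run ω).arr t c : ℝ) ∂μ = lam c := by
    rw [← integral_map (f := fun v : Cl → ℕ => (v c : ℝ)) harr.aemeasurable
      hcoord.aestronglyMeasurable, S.arr_law t, hν.2.2 c]
  have h₁ : ∫ ω, ((S.run ω).arr t c : ℝ) * E.indicator 1 ω ∂μ = lam c * μ.real E := by
    rw [hind.integral_fun_mul_eq_mul_integral (hcoord.comp harr).aestronglyMeasurable
      (hind'.mono (ℱ.le t) le_rfl).aestronglyMeasurable,
      integral_indicator_one (ℱ.le _ _ hE), hmean]
  rw [← h₁]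
  refine (integral_finsetSum _ fun σ _ => integrable_routeCount S A t x c _).symm.trans
    (integral_congr_ae ?_)
  filter_upwards [hadm, hA] with ω hω hAω
  have h₂ := sum_routeCount hω (hAω t c) (fun _ => 1) x
  simp only [one_mul] at h₂
  refine h₂.trans ?_
  by_cases hx : (S.run ω).place t = x
  · simp [E, hx]
  · simp [E, hx]

/-- Up to a vanishing error, the resource used by the mean route frequencies until time `T` is
at most its capacity. -/
theorem exists_tendsto_zero_load_le [IsProbabilityMeasure μ]
    (hadm : ∀ᵐ ω ∂μ, (S.run ω).Admissible ∧ (S.run ω).RateStable)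
    (hA : ∀ᵐ ω ∂μ, ∀ t c, (S.run ω).arr t c ≤ A c)
    {ops : (c : Cl) → Route V (N.len c) → Finset (Operation (N.len c))}
    (hops : ∀ c σ, ∀ o ∈ ops c σ, σ.HasOp o) {cap : ℝ} (hcap0 : 0 ≤ cap)
    (hcap : ∀ R : N.Run, R.Admissible → ∀ t,
      (R.sumReq t fun c τ n => ∑ o ∈ ops c (R.route c τ n), R.serve c τ n o t) ≤ cap) :
    ∃ e : ℕ → ℝ, Tendsto e atTop (𝓝 0) ∧ ∀ T : ℕ,
      ∑ x, ∑ c, ∑ σ : N.EfficientRoute c x, (∑ o ∈ ops c σ.1, N.work c o) *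
        (1 / (T : ℝ) * ∑ t ∈ Finset.range T, ∫ ω, routeCount S A t x c σ.1 ω ∂μ) ≤
        cap + e T := by
  classical
  set f : (c : Cl) → Route V (N.len c) → ℝ := fun c σ => ∑ o ∈ ops c σ, N.work c o
  have hf : ∀ c σ, 0 ≤ f c σ := fun c σ => Finset.sum_nonneg fun o _ => (N.work_pos c o).le
  obtain ⟨δ, hδ, hδN⟩ := exists_pos_le_liveSize N
  set W : ℝ := ∑ c, ∑ σ, f c σ
  have hW0 : 0 ≤ W := Finset.sum_nonneg fun c _ => Finset.sum_nonneg fun σ _ => hf c σ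
  have hW : ∀ c σ, f c σ ≤ W := fun c σ =>
    (Finset.single_le_sum (fun σ _ => hf c σ) (Finset.mem_univ σ)).trans
      (Finset.single_le_sum (f := fun c => ∑ σ, f c σ)
        (fun c _ => Finset.sum_nonneg fun σ _ => hf c σ) (Finset.mem_univ c))
  -- The average load until time `T` of a single realization.
  set D : ℕ → Ω → ℝ := fun T ω => 1 / (T : ℝ) * ∑ t ∈ Finset.range T, ∑ x, ∑ c,
    ∑ σ : N.EfficientRoute c x, f c σ.1 * routeCount S A t x c σ.1 ω
  have hint₀ : ∀ t x c (σ : N.EfficientRoute c x),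
      Integrable (fun ω => f c σ.1 * routeCount S A t x c σ.1 ω) μ := fun t x c σ =>
    (integrable_routeCount S A t x c σ.1).const_mul _
  have hint₁ : ∀ t x c, Integrable (fun ω => ∑ σ : N.EfficientRoute c x,
      f c σ.1 * routeCount S A t x c σ.1 ω) μ := fun t x c =>
    integrable_finsetSum _ fun σ _ => hint₀ t x c σ
  have hint₂ : ∀ t x, Integrable (fun ω => ∑ c, ∑ σ : N.EfficientRoute c x,
      f c σ.1 * routeCount S A t x c σ.1 ω) μ := fun t x =>
    integrable_finsetSum _ fun c _ => hint₁ t x c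
  have hint₃ : ∀ t, Integrable (fun ω => ∑ x, ∑ c, ∑ σ : N.EfficientRoute c x,
      f c σ.1 * routeCount S A t x c σ.1 ω) μ := fun t =>
    integrable_finsetSum _ fun x _ => hint₂ t x
  have hDint : ∀ T, Integrable (D T) μ := fun T =>
    (integrable_finsetSum _ fun t _ => hint₃ t).const_mul _
  have hDmean : ∀ T, ∫ ω, D T ω ∂μ = ∑ x, ∑ c, ∑ σ : N.EfficientRoute c x, f c σ.1 *
        (1 / (T : ℝ) * ∑ t ∈ Finset.range T, ∫ ω, routeCount S A t x c σ.1 ω ∂μ) := by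
    intro T
    have hslot : ∀ t, ∫ ω, ∑ x, ∑ c, ∑ σ : N.EfficientRoute c x,
        f c σ.1 * routeCount S A t x c σ.1 ω ∂μ = ∑ x, ∑ c, ∑ σ : N.EfficientRoute c x,
          f c σ.1 * ∫ ω, routeCount S A t x c σ.1 ω ∂μ := by
      intro t
      refine (integral_finsetSum _ fun x _ => hint₂ t x).trans (Finset.sum_congr rfl fun x _ => ?_)
      refine (integral_finsetSum _ fun c _ => hint₁ t x c).trans
        (Finset.sum_congr rfl fun c _ => ?_)
      refine (integral_finsetSum _ fun σ _ => hint₀ t x c σ).trans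
        (Finset.sum_congr rfl fun σ _ => integral_const_mul _ _)
    simp only [D]
    rw [integral_const_mul, integral_finsetSum _ fun t _ => hint₃ t]
    simp only [hslot, Finset.mul_sum]
    refine Finset.sum_comm.trans (Finset.sum_congr rfl fun x _ => ?_)
    refine Finset.sum_comm.trans (Finset.sum_congr rfl fun c _ => ?_)
    refine Finset.sum_comm.trans (Finset.sum_congr rfl fun σ _ => ?_)
    refine Finset.sum_congr rfl fun t _ => ?_
    ring
  set M : ℝ := ∑ x : N.Placement, ∑ c, ∑ σ : N.EfficientRoute c x, f c σ.1 * A c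
  have hM0 : 0 ≤ M := Finset.sum_nonneg fun x _ => Finset.sum_nonneg fun c _ =>
    Finset.sum_nonneg fun σ _ => mul_nonneg (hf _ _) (Nat.cast_nonneg _)
  have hDM : ∀ T ω, D T ω ≤ M := by
    intro T ω
    have h : ∑ t ∈ Finset.range T, ∑ x, ∑ c,
        ∑ σ : N.EfficientRoute c x, f c σ.1 * routeCount S A t x c σ.1 ω ≤ T * M := by
      refine (Finset.sum_le_card_nsmul _ _ M fun t _ => ?_).trans_eq (by simp)
      exact Finset.sum_le_sum fun x _ => Finset.sum_le_sum fun c _ => Finset.sum_le_sum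
        fun σ _ => mul_le_mul_of_nonneg_left (routeCount_le ..) (hf _ _)
    rcases T.eq_zero_or_pos with rfl | hT
    · simpa [D] using hM0
    · have hT' : (0 : ℝ) < T := by exact_mod_cast hT
      simp only [D]
      rwa [one_div, inv_mul_le_iff₀ hT']
  have hDle : ∀ᵐ ω ∂μ, ∀ T, D T ω - cap ≤ W / δ * (1 / (T : ℝ) * (S.run ω).backlog T) := by
    filter_upwards [hadm, hA] with ω hω hAω T
    rcases T.eq_zero_or_pos with rfl | hT
    · simpa [D] using hcap0
    · have hT' : (0 : ℝ) < T := by exact_mod_cast hT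
      have h := Run.sumReq_work_le hω.1 hops (hcap _ hω.1) hW hW0 hδ hδN T
      simp only [D]
      rw [sum_sum_routeCount hω.1 hAω, sub_le_iff_le_add, one_div, inv_mul_le_iff₀ hT']
      refine h.trans_eq ?_
      field_simp
      ring
  refine ⟨fun T => ∫ ω, max (D T ω - cap) 0 ∂μ, ?_, fun T => ?_⟩
  · suffices h : Tendsto (fun T => ∫ ω, max (D T ω - cap) 0 ∂μ) atTop
        (𝓝 (∫ _ω, (0 : ℝ) ∂μ)) by rwa [integral_zero] at h
    refine tendsto_integral_of_dominated_convergence (fun _ => M)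
      (fun T => ((hDint T).sub (integrable_const cap)).aestronglyMeasurable.sup
        aestronglyMeasurable_const) (integrable_const M) (fun T => ?_) ?_
    · refine Eventually.of_forall fun ω => ?_
      rw [Real.norm_of_nonneg (le_max_right _ _)]
      exact max_le (by linarith [hDM T ω]) hM0
    · filter_upwards [hDle, hadm] with ω hω hst
      have hlim := hst.2.const_mul (W / δ)
      rw [mul_zero] at hlim
      refine squeeze_zero (fun T => le_max_right _ _) (fun T => max_le (hω T) ?_) hlim
      rw [Run.backlog_eq_sumReq]
      exact mul_nonneg (by positivity) (mul_nonneg (by positivity) (Finset.sum_nonneg fun _ _ =>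
        Finset.sum_nonneg fun _ _ => Finset.sum_nonneg fun _ _ => N.requestBacklog_nonneg ..))
  · have hmaxint : Integrable (fun ω => max (D T ω - cap) 0) μ :=
      ((hDint T).sub (integrable_const cap)).sup (integrable_zero _ _ _)
    calc _ = ∫ ω, D T ω ∂μ := (hDmean T).symm
      _ ≤ ∫ ω, (cap + max (D T ω - cap) 0) ∂μ :=
        integral_mono (hDint T) ((integrable_const cap).add hmaxint) fun ω => by
          have := le_max_left (D T ω - cap) 0
          dsimp only
          linarith
      _ = cap + ∫ ω, max (D T ω - cap) 0 ∂μ := by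
        rw [integral_add (integrable_const cap) hmaxint]
        simp

end Frequencies

/-- The capacity conditions in linear form: `F x c σ` is the rate of the requests of client `c` that
get the route `σ` under the placement `x`. Conditional route probabilities are recovered by
division; where the divisor vanishes, so does `F`. -/
theorem satisfiesCapacity_of_frequencies [Fintype V] [Fintype Cl] {lam : Cl → ℝ≥0}
    {P : N.Placement → ℝ} (hP : ∀ x, 0 ≤ P x) (hP1 : ∑ x, P x = 1)
    {F : (x : N.Placement) → (c : Cl) → N.EfficientRoute c x → ℝ} (hF : ∀ x c σ, 0 ≤ F x c σ)
    (hsum : ∀ x c, ∑ σ, F x c σ = lam c * P x)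
    (hnode : ∀ i, ∑ x, ∑ c, ∑ σ : N.EfficientRoute c x, N.nodeLoad c σ.1 i * F x c σ ≤ N.procCap i)
    (hlink : ∀ i j, N.graph.Adj i j →
      ∑ x, ∑ c, ∑ σ : N.EfficientRoute c x, N.linkLoad c σ.1 i j * F x c σ ≤ N.linkCap i j) :
    N.SatisfiesCapacity lam := by
  have hfac : ∀ x c σ, P x * (lam c * (F x c σ / (lam c * P x))) = F x c σ := by
    intro x c σ
    by_cases h : (lam c : ℝ) * P x = 0
    · have h₁ := hsum x c
      rw [h, Finset.sum_eq_zero_iff_of_nonneg fun σ _ => hF x c σ] at h₁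
      simp [h, h₁ σ (Finset.mem_univ σ)]
    · have h₁ := left_ne_zero_of_mul h
      have h₂ := right_ne_zero_of_mul h
      field_simp
  have hload : ∀ f : (c : Cl) → Route V (N.len c) → ℝ,
      ∑ x, P x * ∑ c, (lam c : ℝ) *
        ∑ σ : N.EfficientRoute c x, f c σ.1 * (F x c σ / (lam c * P x)) =
      ∑ x, ∑ c, ∑ σ : N.EfficientRoute c x, f c σ.1 * F x c σ := by
    intro f
    refine Finset.sum_congr rfl fun x _ => ?_
    rw [Finset.mul_sum]
    refine Finset.sum_congr rfl fun c _ => ?_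
    rw [Finset.mul_sum, Finset.mul_sum]
    refine Finset.sum_congr rfl fun σ _ => ?_
    conv_rhs => rw [← hfac x c σ]
    ring
  refine ⟨P, fun x c σ => F x c σ / (lam c * P x), hP, hP1, fun x c σ =>
    div_nonneg (hF x c σ) (mul_nonneg (lam c).2 (hP x)), fun x c hx hc => ?_, fun i => ?_,
    fun i j hij => ?_⟩
  · rw [← Finset.sum_div, hsum]
    exact div_self (mul_ne_zero (by exact_mod_cast hc.ne') hx.ne')
  · exact (hload fun c σ => N.nodeLoad c σ i).trans_le (hnode i)
  · exact (hload fun c σ => N.linkLoad c σ i j).trans_le (hlink i j hij)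

theorem satisfiesCapacity_of_stabilizable [Fintype V] [Fintype Cl] {lam : Cl → ℝ≥0}
    {ν : Measure (Cl → ℕ)} (hν : IsArrivalLaw lam ν) (h : N.Stabilizable ν) :
    N.SatisfiesCapacity lam := by
  obtain ⟨Ω, mΩ, μ, ℱ, S, hμ, hS⟩ := h
  obtain ⟨A, hA⟩ := hν.2.1
  have hA' : ∀ᵐ ω ∂μ, ∀ t c, (S.run ω).arr t c ≤ A c := by
    refine ae_all_iff.2 fun t => ?_
    have h : ∀ᵐ v ∂(μ.map fun ω => (S.run ω).arr t), ∀ c, v c ≤ A c := by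
      rw [S.arr_law t]
      exact hA
    exact ae_of_ae_map ((S.arr_meas t).mono (ℱ.le _) le_rfl).aemeasurable h
  have hadm : ∀ᵐ ω ∂μ, (S.run ω).Admissible := hS.mono fun ω hω => hω.1
  -- Frequencies of the placements and of the routes in the first `T + 1` slots.
  let P : ℕ → N.Placement → ℝ := fun T x =>
    1 / ((T + 1 : ℕ) : ℝ) * ∑ t ∈ Finset.range (T + 1), μ.real {ω | (S.run ω).place t = x}
  let F : ℕ → (x : N.Placement) → (c : Cl) → N.EfficientRoute c x → ℝ := fun T x c σ =>
    1 / ((T + 1 : ℕ) : ℝ) * ∑ t ∈ Finset.range (T + 1), ∫ ω, routeCount S A t x c σ.1 ω ∂μ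
  have hP0 : ∀ T x, 0 ≤ P T x := fun T x =>
    mul_nonneg (by positivity) (Finset.sum_nonneg fun _ _ => measureReal_nonneg)
  have hF0 : ∀ T x c σ, 0 ≤ F T x c σ := fun T x c σ =>
    mul_nonneg (by positivity) (Finset.sum_nonneg fun _ _ =>
      integral_nonneg fun ω => routeCount_nonneg ..)
  have hPsum : ∀ T, ∑ x, P T x = 1 := by
    intro T
    have hslot : ∀ t, ∑ x, μ.real {ω | (S.run ω).place t = x} = 1 := by
      intro t
      rw [← measureReal_iUnion_fintype]
      · have : ⋃ x, {ω | (S.run ω).place t = x} = Set.univ := by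
          ext ω
          simp
        rw [this]
        simp
      · intro x y hxy
        exact Set.disjoint_left.2 fun ω h₁ h₂ => hxy (h₁.symm.trans h₂)
      · exact fun x => ℱ.le _ _ (S.place_meas t x)
    simp only [P]
    rw [← Finset.mul_sum, Finset.sum_comm]
    simp only [hslot, Finset.sum_const, Finset.card_range, nsmul_eq_mul, mul_one]
    exact one_div_mul_cancel (by positivity)
  have hFsum : ∀ T x c, ∑ σ, F T x c σ = lam c * P T x := by
    intro T x c
    simp only [F, P]
    rw [← Finset.mul_sum, Finset.sum_comm]
    simp only [integral_sum_routeCount hν hadm hA', ← Finset.mul_sum]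
    ring
  have hPle : ∀ T x, P T x ≤ 1 := fun T x =>
    (Finset.single_le_sum (fun x _ => hP0 T x) (Finset.mem_univ x)).trans_eq (hPsum T)
  have hFle : ∀ T x c σ, F T x c σ ≤ lam c := fun T x c σ =>
    (Finset.single_le_sum (fun σ _ => hF0 T x c σ) (Finset.mem_univ σ)).trans
      ((hFsum T x c).trans_le (mul_le_of_le_one_right (lam c).2 (hPle T x)))
  obtain ⟨⟨P', F'⟩, -, φ, hφ, hlim⟩ := (isCompact_Icc
    (a := ((fun _ => 0, fun _ _ _ => 0) : (N.Placement → ℝ) ×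
      ((x : N.Placement) → (c : Cl) → N.EfficientRoute c x → ℝ)))
    (b := (fun _ => 1, fun _ c _ => (lam c : ℝ)))).tendsto_subseq
    (x := fun T => (P T, F T)) fun T => ⟨⟨hP0 T, hF0 T⟩, ⟨hPle T, hFle T⟩⟩
  have hPlim : ∀ x, Tendsto (fun k => P (φ k) x) atTop (𝓝 (P' x)) := fun x =>
    tendsto_pi_nhds.1 ((continuous_fst.tendsto _).comp hlim) x
  have hFlim : ∀ x c σ, Tendsto (fun k => F (φ k) x c σ) atTop (𝓝 (F' x c σ)) := fun x c σ =>
    tendsto_pi_nhds.1 (tendsto_pi_nhds.1 (tendsto_pi_nhds.1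
      ((continuous_snd.tendsto _).comp hlim) x) c) σ
  have hload : ∀ (ops : (c : Cl) → Route V (N.len c) → Finset (Operation (N.len c)))
      (cap : ℝ), (∀ c σ, ∀ o ∈ ops c σ, σ.HasOp o) → 0 ≤ cap →
      (∀ R : N.Run, R.Admissible → ∀ t,
        (R.sumReq t fun c τ n => ∑ o ∈ ops c (R.route c τ n), R.serve c τ n o t) ≤ cap) →
      ∑ x, ∑ c, ∑ σ : N.EfficientRoute c x, (∑ o ∈ ops c σ.1, N.work c o) * F' x c σ ≤ cap := by
    intro ops cap hops hcap0 hcap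
    obtain ⟨e, he, hle⟩ := exists_tendsto_zero_load_le hS hA' hops hcap0 hcap
    have he' : Tendsto (fun k => cap + e (φ k + 1)) atTop (𝓝 (cap + 0)) :=
      (he.comp ((tendsto_add_atTop_nat 1).comp hφ.tendsto_atTop)).const_add cap
    rw [add_zero] at he'
    refine le_of_tendsto_of_tendsto' ?_ he' fun k => hle (φ k + 1)
    exact tendsto_finsetSum _ fun x _ => tendsto_finsetSum _ fun c _ =>
      tendsto_finsetSum _ fun σ _ => (hFlim x c σ).const_mul _
  refine satisfiesCapacity_of_frequencies (P := P') (F := F')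
    (fun x => ge_of_tendsto' (hPlim x) fun k => hP0 _ x) ?_
    (fun x c σ => ge_of_tendsto' (hFlim x c σ) fun k => hF0 _ x c σ) (fun x c => ?_)
    (fun i => ?_) fun i j hij => ?_
  · refine tendsto_nhds_unique (tendsto_finsetSum _ fun x _ => hPlim x) ?_
    simp only [hPsum]
    exact tendsto_const_nhds
  · refine tendsto_nhds_unique (tendsto_finsetSum _ fun σ _ => hFlim x c σ) ?_
    simp only [hFsum]
    exact (hPlim x).const_mul _
  · simp only [nodeLoad_eq_sum]
    refine hload (fun c σ => σ.nodeOps i) _ (fun c σ o ho => σ.hasOp_of_mem_nodeOps ho)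
      (N.procCap_pos i).le fun R hR t => ?_
    rw [← Run.nodeUse_eq_sumReq]
    exact hR.node_cap i t
  · simp only [linkLoad_eq_sum]
    refine hload (fun c σ => σ.linkOps i j) _ (fun c σ o ho => σ.hasOp_of_mem_linkOps ho)
      (N.linkCap_pos i j hij).le fun R hR t => ?_
    rw [← Run.linkUse_eq_sumReq]
    exact hR.link_cap i j t hij

end EdgeCloud

/-! ### The stability region and its interior -/

namespace EdgeCloud

variable {V K Φ Cl : Type} [Fintype V] [Fintype K] [Fintype Cl] {N : EdgeCloud V K Φ Cl}

/-- Rounding up or down with one common uniform random number gives a law with prescribed means. -/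
theorem exists_isArrivalLaw {Cl : Type} [Finite Cl] (lam : Cl → ℝ≥0) :
    ∃ ν : Measure (Cl → ℕ), IsArrivalLaw lam ν := by
  classical
  let μ : Measure ℝ := volume.restrict (Set.Ioc 0 1)
  have hμ : IsProbabilityMeasure μ := ⟨by simp [μ]⟩
  let X : ℝ → Cl → ℕ := fun u c =>
    ⌊lam c⌋₊ + if u ≤ lam c - (⌊lam c⌋₊ : ℝ) then 1 else 0
  have hX : Measurable X := measurable_pi_lambda _ fun c =>
    measurable_const.add (Measurable.ite measurableSet_Iic measurable_const measurable_const)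
  refine ⟨μ.map X, Measure.isProbabilityMeasure_map hX.aemeasurable,
    ⟨fun c => ⌊lam c⌋₊ + 1, ?_⟩, fun c => ?_⟩
  · rw [ae_map_iff hX.aemeasurable]
    · refine Eventually.of_forall fun u c => ?_
      simp only [X]
      split_ifs <;> omega
    · exact MeasurableSet.of_discrete
  · have h₁ : 0 ≤ (lam c : ℝ) - (⌊lam c⌋₊ : ℝ) := by
      have := Nat.floor_le (zero_le : 0 ≤ lam c)
      exact sub_nonneg.2 (by exact_mod_cast this)
    have h₂ : (lam c : ℝ) - (⌊lam c⌋₊ : ℝ) ≤ 1 := by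
      have := (Nat.lt_floor_add_one (lam c)).le
      rw [sub_le_iff_le_add']
      exact_mod_cast this
    rw [integral_map hX.aemeasurable (Measurable.aestronglyMeasurable (by fun_prop))]
    have h₃ : ∀ u, ((X u c : ℕ) : ℝ) = (⌊lam c⌋₊ : ℝ) +
        (Set.Iic ((lam c : ℝ) - (⌊lam c⌋₊ : ℝ))).indicator 1 u := by
      intro u
      by_cases hu : u ≤ (lam c : ℝ) - (⌊lam c⌋₊ : ℝ) <;> simp [X, hu]
    simp only [h₃]
    have h₄ : Integrable
        ((Set.Iic ((lam c : ℝ) - (⌊lam c⌋₊ : ℝ))).indicator (1 : ℝ → ℝ)) μ :=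
      (integrable_const (1 : ℝ)).indicator measurableSet_Iic
    rw [integral_add (integrable_const _) h₄,
      integral_indicator_one measurableSet_Iic, measureReal_def,
      Measure.restrict_apply measurableSet_Iic, Set.inter_comm, Set.Ioc_inter_Iic,
      inf_eq_right.2 h₂, Real.volume_Ioc, sub_zero, ENNReal.toReal_ofReal h₁]
    simp

theorem stabilizable_iff {lam : Cl → ℝ≥0} {ν : Measure (Cl → ℕ)} (hν : IsArrivalLaw lam ν) :
    N.Stabilizable ν ↔ N.SatisfiesCapacity lam :=
  ⟨satisfiesCapacity_of_stabilizable hν, stabilizable_of_satisfiesCapacity hν⟩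

theorem mem_stabilityRegion_iff {lam : Cl → ℝ≥0} :
    lam ∈ N.stabilityRegion ↔ N.SatisfiesCapacity lam := by
  refine ⟨fun h => ?_, fun h ν hν => (stabilizable_iff hν).2 h⟩
  obtain ⟨ν, hν⟩ := exists_isArrivalLaw lam
  exact (stabilizable_iff hν).1 (h ν hν)

theorem mem_interior_of_satisfiesCapacityStrictly {lam : Cl → ℝ≥0}
    (h : N.SatisfiesCapacityStrictly lam) : lam ∈ interior N.stabilityRegion := by
  obtain ⟨P, Q, hP, hP1, hQ, hQ1, hnode, hlink⟩ := h
  have hcn : ∀ i, Continuous fun l : Cl → ℝ≥0 => N.expNodeLoad l P Q i := fun i => by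
    unfold expNodeLoad
    fun_prop
  have hcl : ∀ i j, Continuous fun l : Cl → ℝ≥0 => N.expLinkLoad l P Q i j := fun i j => by
    unfold expLinkLoad
    fun_prop
  rw [mem_interior_iff_mem_nhds]
  have h₁ : ∀ᶠ l in 𝓝 lam, ∀ i, N.expNodeLoad l P Q i < N.procCap i :=
    eventually_all.2 fun i => (hcn i).continuousAt.eventually_lt continuousAt_const (hnode i)
  have h₂ : ∀ᶠ l in 𝓝 lam, ∀ i j, N.graph.Adj i j → N.expLinkLoad l P Q i j < N.linkCap i j :=
    eventually_all.2 fun i => eventually_all.2 fun j => by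
      by_cases hij : N.graph.Adj i j
      · filter_upwards [(hcl i j).continuousAt.eventually_lt continuousAt_const (hlink i j hij)]
          with l hl _ using hl
      · exact Eventually.of_forall fun l h => absurd h hij
  filter_upwards [h₁, h₂] with l hl₁ hl₂
  exact mem_stabilityRegion_iff.2 ⟨P, Q, hP, hP1, hQ, fun x c hx _ => hQ1 x c hx,
    fun i => (hl₁ i).le, fun i j hij => (hl₂ i j hij).le⟩

/-- A nonnegative load that is linear in the rates leaves slack at `lam` if it respects a positive
capacity at a vector that exceeds `lam` by a positive factor. -/
theorem load_lt_of_load_le {P : N.Placement → ℝ}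
    {Q : (x : N.Placement) → (c : Cl) → N.EfficientRoute c x → ℝ} (hP : ∀ x, 0 ≤ P x)
    (hQ : ∀ x c σ, 0 ≤ Q x c σ) {f : (c : Cl) → Route V (N.len c) → ℝ} (hf : ∀ c σ, 0 ≤ f c σ)
    {lam l : Cl → ℝ≥0} {ε cap : ℝ} (hε : 0 < ε) (hcap : 0 < cap)
    (hl : ∀ c, (1 + ε) * lam c ≤ l c)
    (h : ∑ x, P x * ∑ c, (l c : ℝ) * ∑ σ : N.EfficientRoute c x, f c σ.1 * Q x c σ ≤ cap) :
    ∑ x, P x * ∑ c, (lam c : ℝ) * ∑ σ : N.EfficientRoute c x, f c σ.1 * Q x c σ < cap := by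
  have h₁ : (1 + ε) * ∑ x, P x * ∑ c, (lam c : ℝ) * ∑ σ : N.EfficientRoute c x,
      f c σ.1 * Q x c σ ≤ cap := by
    refine le_trans ?_ h
    rw [Finset.mul_sum]
    refine Finset.sum_le_sum fun x _ => ?_
    rw [mul_left_comm]
    refine mul_le_mul_of_nonneg_left ?_ (hP x)
    rw [Finset.mul_sum]
    refine Finset.sum_le_sum fun c _ => ?_
    rw [← mul_assoc]
    exact mul_le_mul_of_nonneg_right (hl c)
      (Finset.sum_nonneg fun σ _ => mul_nonneg (hf _ _) (hQ x c σ))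
  by_contra! h₂
  nlinarith

theorem satisfiesCapacityStrictly_of_mem_interior {lam : Cl → ℝ≥0}
    (h : lam ∈ interior N.stabilityRegion) : N.SatisfiesCapacityStrictly lam := by
  -- Enlarge the rates by a factor, for the slack, and by a constant, to give every client routes.
  have hcont : Continuous fun ε : ℝ≥0 => fun c => (1 + ε) * lam c + ε := by fun_prop
  have h₀ : ∀ᶠ ε in 𝓝 (0 : ℝ≥0), (fun c => (1 + ε) * lam c + ε) ∈ N.stabilityRegion := by
    refine hcont.continuousAt.eventually_mem ?_
    simpa using mem_interior_iff_mem_nhds.1 h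
  obtain ⟨ε, hmem, hε⟩ := ((h₀.filter_mono nhdsWithin_le_nhds).and
    (self_mem_nhdsWithin : Set.Ioi (0 : ℝ≥0) ∈ 𝓝[>] 0)).exists
  have hε' : 0 < ε := hε
  obtain ⟨P, Q, hP, hP1, hQ, hQ1, hnode, hlink⟩ := mem_stabilityRegion_iff.1 hmem
  have hl : ∀ c, (1 + (ε : ℝ)) * lam c ≤ (((1 + ε) * lam c + ε : ℝ≥0) : ℝ) := fun c => by
    push_cast
    linarith [ε.2]
  refine ⟨P, Q, hP, hP1, hQ, fun x c hx => hQ1 x c hx (by positivity), fun i => ?_,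
    fun i j hij => ?_⟩
  · exact load_lt_of_load_le hP hQ (fun c σ => N.nodeLoad_nonneg c σ i)
      (NNReal.coe_pos.2 hε') (N.procCap_pos i) hl (hnode i)
  · exact load_lt_of_load_le hP hQ (fun c σ => N.linkLoad_nonneg c σ i j)
      (NNReal.coe_pos.2 hε') (N.linkCap_pos i j hij) hl (hlink i j hij)

end EdgeCloud

theorem mainTheorem4 {V K Φ Cl : Type} [Fintype V] [Fintype K] [Fintype Cl]
    (N : EdgeCloud V K Φ Cl) (lam : Cl → ℝ≥0) :
    (∀ ν : Measure (Cl → ℕ), EdgeCloud.IsArrivalLaw lam ν →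
      (N.Stabilizable ν ↔ N.SatisfiesCapacity lam)) ∧
    (lam ∈ N.stabilityRegion ↔ N.SatisfiesCapacity lam) ∧
    (lam ∈ interior N.stabilityRegion ↔ N.SatisfiesCapacityStrictly lam) :=
  ⟨fun _ hν => EdgeCloud.stabilizable_iff hν, EdgeCloud.mem_stabilityRegion_iff,
    EdgeCloud.satisfiesCapacityStrictly_of_mem_interior,
    EdgeCloud.mem_interior_of_satisfiesCapacityStrictly⟩
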